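/- Let $\Omega\subset\mathbb R^N$ be an open set and let $\mathscr A$ be an $N\times N$ matrix function on $\Omega$ with complex valued entries in $L^\infty(\Omega)$; $\Re\mathscr A$ and $\Im\mathscr A$ denote the matrices of the real and imaginary parts of its entries. Let $\mathring H^1(\Omega)$ be the closure of the space of complex valued $C^\infty$ functions with compact support in $\Omega$ in the norm $\left(\int_\Omega(|u|^2+|\nabla u|^2)\,dx\right)^{1/2}$. Let $\varphi:(0,+\infty)\to(0,+\infty)$ satisfy: 1. $\varphi\in C^1((0,+\infty))$; 2. $(s\varphi(s))'>0$ for all $s>0$; 3. the range of $s\mapsto s\varphi(s)$, $s>0$, is $(0,+\infty)$; 4. there are $C_1,C_2>0$, $r>-1$ and $s_0>0$ with $C_1s^r\le(s\varphi(s))'\le C_2s^r$ for $s\in(0,s_0)$; if $r=0$, moreover, the limit $\lim_{s\to0^+}\varphi(s)$ exists, is finite and positive, and $\lim_{s\to0^+}s\varphi'(s)=0$; 5. there is $s_1>s_0$ such that either $\varphi'(s)\ge0$ for all $s\ge s_1$, or $\varphi'(s)\le0$ for all $s\ge s_1$. Put $\Phi(s)=\int_0^s\sigma\varphi(\sigma)\,d\sigma$.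 The operator $Eu=\nabla(\mathscr A\nabla u)$ is called $L^\Phi$-dissipative if $$\Re\int_\Omega\langle\mathscr A\nabla u,\nabla(\varphi(|u|)\,u)\rangle\,dx\ge0$$ for every $u\in\mathring H^1(\Omega)$ such that $\varphi(|u|)\,u\in\mathring H^1(\Omega)$, where $\varphi(|u|)\,u$ is taken to be zero where $u$ vanishes. Theorem. Let $\Im\mathscr A$ be symmetric, i.e. $(\Im\mathscr A)^t=\Im\mathscr A$ almost everywhere in $\Omega$. Then $E$ is $L^\Phi$-dissipative if and only if $$|s\,\varphi'(s)|\,|\langle\Im\mathscr A(x)\xi,\xi\rangle|\le2\sqrt{\varphi(s)\,[s\varphi(s)]'}\,\langle\Re\mathscr A(x)\xi,\xi\rangle$$ for almost every $x\in\Omega$ and for all $s>0$, $\xi\in\mathbb R^N$. -/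

import Mathlib

open MeasureTheory Filter Topology Set
open scoped ENNReal Matrix

noncomputable section

/-- The classical gradient `(∂₁ f, …, ∂_N f)` of a complex valued function on `ℝ^N`. -/
def classicalGradient {N : ℕ} (f : EuclideanSpace ℝ (Fin N) → ℂ) (x : EuclideanSpace ℝ (Fin N)) :
    EuclideanSpace ℂ (Fin N) :=
  WithLp.toLp 2 fun i => fderiv ℝ f x (EuclideanSpace.single i 1)

/-- `g` is the weak gradient of `u` on the open set `Ω`:
`∫_Ω u ∂ᵢf = - ∫_Ω gᵢ f` for all `f ∈ C_c^∞(Ω; ℂ)` and all `i`. -/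
structure HasWeakGradient {N : ℕ} (Ω : TopologicalSpace.Opens (EuclideanSpace ℝ (Fin N)))
    (u : EuclideanSpace ℝ (Fin N) → ℂ)
    (g : EuclideanSpace ℝ (Fin N) → EuclideanSpace ℂ (Fin N)) : Prop where
  locallyIntegrableOn : LocallyIntegrableOn u Ω volume
  locallyIntegrableOn_grad : LocallyIntegrableOn g Ω volume
  integral_eq : ∀ (f : TestFunction Ω ℂ ⊤) (i : Fin N),
    ∫ x in (Ω : Set (EuclideanSpace ℝ (Fin N))), u x * classicalGradient f x i =
      -∫ x in (Ω : Set (EuclideanSpace ℝ (Fin N))), g x i * f x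

/-- The space `H̊¹(Ω)`: functions `u ∈ L²(Ω)` with weak gradient in `L²(Ω)` which are limits of
functions of `C_c^∞(Ω; ℂ)` in the norm given by `∫_Ω (|u|² + |∇u|²)`. -/
def MemH10 {N : ℕ} (Ω : TopologicalSpace.Opens (EuclideanSpace ℝ (Fin N)))
    (u : EuclideanSpace ℝ (Fin N) → ℂ) : Prop :=
  MemLp u 2 (volume.restrict Ω) ∧
  ∃ g : EuclideanSpace ℝ (Fin N) → EuclideanSpace ℂ (Fin N),
    HasWeakGradient Ω u g ∧ MemLp g 2 (volume.restrict Ω) ∧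
    ∀ ε : ℝ≥0∞, 0 < ε → ∃ f : TestFunction Ω ℂ ⊤,
      ∫⁻ x in (Ω : Set (EuclideanSpace ℝ (Fin N))),
        (‖u x - f x‖ₑ ^ 2 + ‖g x - classicalGradient f x‖ₑ ^ 2) < ε

/-- The function `φ(|u|) u`; it is zero wherever `u` is zero. -/
def phiMul {N : ℕ} (φ : ℝ → ℝ) (u : EuclideanSpace ℝ (Fin N) → ℂ) :
    EuclideanSpace ℝ (Fin N) → ℂ :=
  fun x => (φ ‖u x‖ : ℂ) * u x

/-- The sesquilinear form `∫_Ω ⟨A ∇u, ∇v⟩ dx`, as a function of `g = ∇u` and `h = ∇v`;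
here `⟨a, b⟩ = ∑ aᵢ conj(bᵢ)`. -/
def gradForm {N : ℕ} (Ω : TopologicalSpace.Opens (EuclideanSpace ℝ (Fin N)))
    (A : EuclideanSpace ℝ (Fin N) → Matrix (Fin N) (Fin N) ℂ)
    (g h : EuclideanSpace ℝ (Fin N) → EuclideanSpace ℂ (Fin N)) : ℂ :=
  ∫ x in (Ω : Set (EuclideanSpace ℝ (Fin N))), (A x *ᵥ (g x).ofLp) ⬝ᵥ star (h x).ofLp

/-- Functional (`L^Φ`-) dissipativity of `E u = ∇(A ∇u)`, where `Φ(s) = ∫₀ˢ σ φ(σ) dσ`: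
`Re ∫_Ω ⟨A ∇u, ∇(φ(|u|) u)⟩ dx ≥ 0` for all `u ∈ H̊¹(Ω)` with `φ(|u|) u ∈ H̊¹(Ω)`.
Weak gradients exist for such functions and are unique almost everywhere in `Ω`. -/
def IsFunctionalDissipative {N : ℕ} (Ω : TopologicalSpace.Opens (EuclideanSpace ℝ (Fin N)))
    (A : EuclideanSpace ℝ (Fin N) → Matrix (Fin N) (Fin N) ℂ) (φ : ℝ → ℝ) : Prop :=
  ∀ u : EuclideanSpace ℝ (Fin N) → ℂ, MemH10 Ω u → MemH10 Ω (phiMul φ u) →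
    ∀ g h : EuclideanSpace ℝ (Fin N) → EuclideanSpace ℂ (Fin N),
      HasWeakGradient Ω u g → HasWeakGradient Ω (phiMul φ u) h →
        0 ≤ (gradForm Ω A g h).re

/-- The class of admissible functions `φ : (0, ∞) → (0, ∞)` (values of `φ` outside `(0, ∞)` are
irrelevant). -/
structure IsAdmissible (φ : ℝ → ℝ) : Prop where
  pos : ∀ s, 0 < s → 0 < φ s
  contDiffOn : ContDiffOn ℝ 1 φ (Ioi 0)
  deriv_pos : ∀ s, 0 < s → 0 < deriv (fun σ => σ * φ σ) s
  range_eq : (fun s => s * φ s) '' Ioi 0 = Ioi 0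
  behaviour : ∃ s₀ : ℝ, 0 < s₀ ∧
    -- near the origin
    (∃ C₁ C₂ r : ℝ, 0 < C₁ ∧ 0 < C₂ ∧ -1 < r ∧
      (∀ s ∈ Ioo 0 s₀, C₁ * s ^ r ≤ deriv (fun σ => σ * φ σ) s ∧
        deriv (fun σ => σ * φ σ) s ≤ C₂ * s ^ r) ∧
      (r = 0 → (∃ L : ℝ, 0 < L ∧ Tendsto φ (𝓝[>] 0) (𝓝 L)) ∧
        Tendsto (fun s => s * deriv φ s) (𝓝[>] 0) (𝓝 0))) ∧
    -- at infinity
    (∃ s₁ : ℝ, s₀ < s₁ ∧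
      ((∀ s, s₁ ≤ s → 0 ≤ deriv φ s) ∨ (∀ s, s₁ ≤ s → deriv φ s ≤ 0)))

/-- The real quadratic form `⟨B ξ, ξ⟩`. -/
def quadForm {N : ℕ} (B : Matrix (Fin N) (Fin N) ℝ) (ξ : Fin N → ℝ) : ℝ :=
  (B *ᵥ ξ) ⬝ᵥ ξ

end

/-! Let `ψ(s) = s φ(s)`. Where `u ≠ 0`, write `∇u = u (p + i q)` with `p`, `q` real. The map `z ↦
φ(|z|) z` stretches the radial direction by `ψ'` and the angular one by `φ`, so `∇(φ(|u|) u) = u (ψ'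
p + i φ q)`. Since `Im A` is symmetric, with `s = |u|`, `Re ⟨A ∇u, ∇(φ(|u|) u)⟩ = s² (ψ' ⟨Re A p, p⟩
+ φ ⟨Re A q, q⟩ - s φ' ⟨Im A p, q⟩)`. The inequality of the theorem says exactly that this form is
nonnegative for all `p`, `q`: take `p`, `q` parallel for one direction, polarize for the other
(`quadForm_add_nonneg`).

Sufficiency is then pointwise, once the chain rule is justified. The map `z ↦ φ(|z|) z` need not be
Lipschitz near `0` or near infinity, so the rule is proved through cut-offs: `∇u = 0` almost
everywhere on `{u = 0}` (`MemH10.ae_eq_zero_of_eq_zero`), and the formula holds almost everywhere on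
`{u ≠ 0}` (`IsAdmissible.ae_weakGradient_phiMul`).

For necessity, test with `u = ρ^m exp(iθ)`. For `m` large both `u` and `φ(|u|) u` are `C¹` with
compact support (`IsAdmissible.exists_contDiff_powMul`), and dissipativity becomes the sign of a
real form in `∇ρ`, `∇θ` (`IsFunctionalDissipative.polarForm_nonneg`). Let `ρ` be a constant `τ` plus
a small fast oscillation in direction `ξ`, and `θ` a multiple of the same oscillation, both
localized. The leading terms give `∫ ζ² Q ≥ 0` for every cut-off `ζ`, where `Q` is the form above at
`s = τ^m` with `p`, `q` parallel to `ξ` (`IsCutoffPair.integral_sq_mul_quadForm_nonneg`). Lebesgue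
differentiation gives `Q ≥ 0` almost everywhere; density and continuity in `(s, ξ)` leave a single
null set. -/

/-! ### Classical and weak gradients, and the space `H̊¹(Ω)`. -/

theorem MeasureTheory.LocallyIntegrableOn.integrable_smul_of_hasCompactSupport {X E 𝕜 : Type*}
    [TopologicalSpace X] [T2Space X] [MeasurableSpace X] [OpensMeasurableSpace X]
    [SecondCountableTopology X]
    [NormedField 𝕜] [NormedAddCommGroup E] [NormedSpace 𝕜 E] {μ : Measure X} {s : Set X}
    {f : X → E} (hf : LocallyIntegrableOn f s μ) {ψ : X → 𝕜} (hψ : Continuous ψ)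
    (hc : HasCompactSupport ψ) (hs : tsupport ψ ⊆ s) : Integrable (fun x => ψ x • f x) μ := by
  have h1 : IntegrableOn (fun x => ψ x • f x) (tsupport ψ) μ :=
    (hf.integrableOn_compact_subset hs hc).continuousOn_smul hψ.continuousOn hc
  refine (integrableOn_iff_integrable_of_support_subset ?_).1 h1
  exact (Function.support_smul_subset_left _ _).trans (subset_tsupport _)

theorem classicalGradient_apply {N : ℕ} (f : EuclideanSpace ℝ (Fin N) → ℂ)
    (x : EuclideanSpace ℝ (Fin N)) (i : Fin N) :
    classicalGradient f x i = fderiv ℝ f x (EuclideanSpace.single i 1) := rfl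

theorem continuous_classicalGradient {N : ℕ} {f : EuclideanSpace ℝ (Fin N) → ℂ}
    (hf : ContDiff ℝ 1 f) : Continuous (classicalGradient f) := by
  have h := hf.continuous_fderiv one_ne_zero
  exact (PiLp.continuous_toLp 2 _).comp
    (continuous_pi fun i => h.clm_apply continuous_const)

theorem support_classicalGradient_subset {N : ℕ} (f : EuclideanSpace ℝ (Fin N) → ℂ) :
    Function.support (classicalGradient f) ⊆ tsupport f := by
  intro x hx
  by_contra h
  apply hx
  have : fderiv ℝ f x = 0 := by
    by_contra h'
    exact h (support_fderiv_subset ℝ h')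
  ext i
  simp [classicalGradient_apply, this]

theorem HasCompactSupport.classicalGradient {N : ℕ} {f : EuclideanSpace ℝ (Fin N) → ℂ}
    (hf : HasCompactSupport f) : HasCompactSupport (classicalGradient f) :=
  hf.mono' (support_classicalGradient_subset f)

theorem hasWeakGradient_of_contDiff {N : ℕ} (Ω : TopologicalSpace.Opens (EuclideanSpace ℝ (Fin N)))
    {v : EuclideanSpace ℝ (Fin N) → ℂ} (hv : ContDiff ℝ 1 v) :
    HasWeakGradient Ω v (classicalGradient v) where
  locallyIntegrableOn := hv.continuous.locallyIntegrable.locallyIntegrableOn _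
  locallyIntegrableOn_grad :=
    (continuous_classicalGradient hv).locallyIntegrable.locallyIntegrableOn _
  integral_eq f i := by
    have hf : ContDiff ℝ 1 f := f.contDiff.of_le (by norm_cast)
    have hz : ∀ x, x ∉ (Ω : Set _) → x ∉ tsupport f := fun x hx h => hx (f.tsupport_subset h)
    have hcg := continuous_classicalGradient hf
    have hcv := continuous_classicalGradient hv
    rw [setIntegral_eq_integral_of_forall_compl_eq_zero, setIntegral_eq_integral_of_forall_compl_eq_zero]
    · refine integral_mul_fderiv_eq_neg_fderiv_mul_of_integrable ?_ ?_ ?_ ?_ ?_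
      · exact (((PiLp.continuous_apply 2 _ i).comp hcv).mul hf.continuous).integrable_of_hasCompactSupport
          f.hasCompactSupport.mul_left
      · refine (hv.continuous.mul ((PiLp.continuous_apply 2 _ i).comp hcg)).integrable_of_hasCompactSupport
          (HasCompactSupport.mul_left ?_)
        exact f.hasCompactSupport.fderiv_apply (𝕜 := ℝ) _
      · exact (hv.continuous.mul hf.continuous).integrable_of_hasCompactSupport
          f.hasCompactSupport.mul_left
      · exact fun x _ => (hv.differentiable one_ne_zero) x
      · exact fun x _ => (hf.differentiable one_ne_zero) x
    · intro x hx
      rw [image_eq_zero_of_notMem_tsupport (hz x hx), mul_zero]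
    · intro x hx
      have : classicalGradient f x = 0 := by
        by_contra h
        exact hz x hx (support_classicalGradient_subset f h)
      simp [this]

/-- The complex valued test function given by a real valued one. -/
noncomputable def realTestFunction {N : ℕ} (Ω : TopologicalSpace.Opens (EuclideanSpace ℝ (Fin N)))
    (g : EuclideanSpace ℝ (Fin N) → ℝ) (hg : ContDiff ℝ (⊤ : ℕ∞) g) (hc : HasCompactSupport g)
    (hs : tsupport g ⊆ Ω) : TestFunction Ω ℂ ⊤ where
  toFun x := (g x : ℂ)
  contDiff' := Complex.ofRealCLM.contDiff.comp hg
  hasCompactSupport' := hc.comp_left (g := fun t : ℝ => (t : ℂ)) (by simp)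
  tsupport_subset' := by
    refine (closure_mono ?_).trans hs
    intro x hx h
    apply hx
    simp [h]

/-- Fundamental lemma of the calculus of variations, applied to each component of `g - g'`; real
test functions already suffice. -/
theorem HasWeakGradient.ae_eq {N : ℕ} {Ω : TopologicalSpace.Opens (EuclideanSpace ℝ (Fin N))}
    {u u' : EuclideanSpace ℝ (Fin N) → ℂ}
    {g g' : EuclideanSpace ℝ (Fin N) → EuclideanSpace ℂ (Fin N)}
    (h : HasWeakGradient Ω u g) (h' : HasWeakGradient Ω u' g')
    (huu : u =ᵐ[volume.restrict (Ω : Set (EuclideanSpace ℝ (Fin N)))] u') :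
    g =ᵐ[volume.restrict (Ω : Set (EuclideanSpace ℝ (Fin N)))] g' := by
  have key : ∀ i : Fin N, ∀ᵐ x, x ∈ (Ω : Set (EuclideanSpace ℝ (Fin N))) → g x i - g' x i = 0 := by
    intro i
    have hl : ∀ {G : EuclideanSpace ℝ (Fin N) → EuclideanSpace ℂ (Fin N)},
        LocallyIntegrableOn G Ω volume → LocallyIntegrableOn (fun x => G x i) Ω volume := by
      intro G hG x hx
      obtain ⟨s, hs, hi⟩ := hG x hx
      exact ⟨s, hs, (EuclideanSpace.proj (𝕜 := ℂ) i).integrable_comp hi⟩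
    have hgi := hl h.locallyIntegrableOn_grad
    have hgi' := hl h'.locallyIntegrableOn_grad
    refine Ω.isOpen.ae_eq_zero_of_integral_contDiff_smul_eq_zero (hgi.sub hgi') ?_
    intro ψ hψ hc hs
    have e1 := h.integral_eq (realTestFunction Ω ψ hψ hc hs) i
    have e2 := h'.integral_eq (realTestFunction Ω ψ hψ hc hs) i
    have e3 : ∀ G : EuclideanSpace ℝ (Fin N) → EuclideanSpace ℂ (Fin N),
        LocallyIntegrableOn G Ω volume →
        Integrable (fun x => ψ x • G x i) volume := by
      intro G hG
      exact (hl hG).integrable_smul_of_hasCompactSupport hψ.continuous hc hs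
    have e4 : ∀ G : EuclideanSpace ℝ (Fin N) → EuclideanSpace ℂ (Fin N),
        ∫ x in (Ω : Set (EuclideanSpace ℝ (Fin N))), G x i * (realTestFunction Ω ψ hψ hc hs) x
          = ∫ x, ψ x • G x i := by
      intro G
      rw [setIntegral_eq_integral_of_forall_compl_eq_zero]
      · refine integral_congr_ae (Eventually.of_forall fun x => ?_)
        change G x i * (ψ x : ℂ) = _
        simp [mul_comm]
      · intro x hx
        change G x i * (ψ x : ℂ) = _
        rw [image_eq_zero_of_notMem_tsupport (fun h => hx (hs h))]; simp
    have e5 : ∫ x in (Ω : Set (EuclideanSpace ℝ (Fin N))),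
        u x * classicalGradient (realTestFunction Ω ψ hψ hc hs) x i =
        ∫ x in (Ω : Set (EuclideanSpace ℝ (Fin N))),
        u' x * classicalGradient (realTestFunction Ω ψ hψ hc hs) x i := by
      refine integral_congr_ae ?_
      filter_upwards [huu] with x hx
      rw [hx]
    rw [e4] at e1 e2
    simp only [smul_sub]
    rw [integral_sub (e3 g h.locallyIntegrableOn_grad) (e3 g' h'.locallyIntegrableOn_grad), sub_eq_zero]
    rw [e1, e2, neg_inj] at e5
    exact e5
  rw [EventuallyEq, ae_restrict_iff' Ω.isOpen.measurableSet]
  filter_upwards [ae_all_iff.2 key] with x hx hxΩ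
  ext i
  exact sub_eq_zero.1 (hx i hxΩ)

/-- Mollification. The compact set is fixed before the tolerance, so that uniform closeness yields
closeness in `L²`. -/
theorem exists_testFunction_near {N : ℕ} {Ω : TopologicalSpace.Opens (EuclideanSpace ℝ (Fin N))}
    {v : EuclideanSpace ℝ (Fin N) → ℂ} (hv : ContDiff ℝ 1 v) (hc : HasCompactSupport v)
    (hs : tsupport v ⊆ Ω) :
    ∃ K : Set (EuclideanSpace ℝ (Fin N)), IsCompact K ∧ ∀ e : ℝ, 0 < e →
      ∃ f : TestFunction Ω ℂ ⊤, (∀ x ∉ K, v x - f x = 0 ∧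
        classicalGradient v x - classicalGradient f x = 0) ∧
        ∀ x, ‖v x - f x‖ ≤ e ∧ ∀ i, ‖classicalGradient v x i - classicalGradient f x i‖ ≤ e := by
  obtain ⟨δ₀, hδ₀, hδ₀s⟩ := hc.isCompact.exists_cthickening_subset_open Ω.isOpen hs
  refine ⟨Metric.cthickening δ₀ (tsupport v), hc.isCompact.cthickening, fun e he => ?_⟩
  have huv := hc.uniformContinuous_of_continuous hv.continuous
  have hcf : Continuous (fderiv ℝ v) := hv.continuous_fderiv one_ne_zero
  have hcf' : ∀ i : Fin N, Continuous fun x => fderiv ℝ v x (EuclideanSpace.single i 1) :=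
    fun i => hcf.clm_apply continuous_const
  have hug : ∀ i : Fin N, UniformContinuous fun x => fderiv ℝ v x (EuclideanSpace.single i 1) :=
    fun i => (hc.fderiv_apply (𝕜 := ℝ) _).uniformContinuous_of_continuous (hcf' i)
  obtain ⟨δ₁, hδ₁, h₁⟩ := Metric.uniformContinuous_iff.1 huv e he
  have : ∃ δ₂ > 0, ∀ i : Fin N, ∀ a b : EuclideanSpace ℝ (Fin N), dist a b < δ₂ →
      dist (fderiv ℝ v a (EuclideanSpace.single i 1)) (fderiv ℝ v b (EuclideanSpace.single i 1))
        < e := by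
    choose d hd hd' using fun i => Metric.uniformContinuous_iff.1 (hug i) e he
    rcases isEmpty_or_nonempty (Fin N) with hN | hN
    · exact ⟨1, one_pos, fun i => hN.elim i⟩
    · refine ⟨Finset.univ.inf' Finset.univ_nonempty d, ?_, fun i a b hab => hd' i ?_⟩
      · simpa [Finset.lt_inf'_iff] using hd
      · exact hab.trans_le (Finset.inf'_le _ (Finset.mem_univ i))
  obtain ⟨δ₂, hδ₂, h₂⟩ := this
  -- `δ₀` controls the support of the mollified function; `δ₁` and `δ₂` are moduli of continuity for
  -- `v` and for its partial derivatives.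
  set δ := min δ₀ (min δ₁ δ₂) with hδ
  have hδp : 0 < δ := by positivity
  let φ : ContDiffBump (0 : EuclideanSpace ℝ (Fin N)) := ⟨δ / 2, δ, by linarith, by linarith⟩
  let F : EuclideanSpace ℝ (Fin N) → ℂ :=
    convolution (φ.normed volume) v (ContinuousLinearMap.lsmul ℝ ℝ) volume
  have hφl : LocallyIntegrable (φ.normed (volume : Measure (EuclideanSpace ℝ (Fin N)))) volume :=
    φ.continuous_normed.locallyIntegrable
  have hFs : Function.support F ⊆ Metric.cthickening δ₀ (tsupport v) := by
    intro x hx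
    obtain ⟨a, ha, b, hb, rfl⟩ := support_convolution_subset _ hx
    rw [φ.support_normed_eq, mem_ball_zero_iff] at ha
    refine Metric.mem_cthickening_of_dist_le _ b _ _ (subset_tsupport v hb) ?_
    simpa [dist_eq_norm] using ha.le.trans (min_le_left _ _)
  have hFt : tsupport F ⊆ Metric.cthickening δ₀ (tsupport v) :=
    closure_minimal hFs Metric.isClosed_cthickening
  have hFd : ContDiff ℝ ((⊤ : ℕ∞) : WithTop ℕ∞) F :=
    φ.hasCompactSupport_normed.contDiff_convolution_left _ φ.contDiff_normed
      hv.continuous.locallyIntegrable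
  have hFg : ∀ x i, fderiv ℝ F x (EuclideanSpace.single i 1) =
      convolution (φ.normed volume) (fun y => fderiv ℝ v y (EuclideanSpace.single i 1))
        (ContinuousLinearMap.lsmul ℝ ℝ) volume x := by
    intro x i
    have := hc.hasFDerivAt_convolution_right (ContinuousLinearMap.lsmul ℝ ℝ) hφl hv x
    rw [this.fderiv, convolution_precompR_apply _ hφl (hc.fderiv (𝕜 := ℝ)) hcf]
  refine ⟨⟨F, hFd, hc.isCompact.cthickening.of_isClosed_subset (isClosed_tsupport F) hFt,
    hFt.trans hδ₀s⟩, ?_, ?_⟩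
  · intro x hx
    have hxF : x ∉ tsupport F := fun h => hx (hFt h)
    have hxv : x ∉ tsupport v := fun h => hx (Metric.self_subset_cthickening _ h)
    have hg : ∀ w : EuclideanSpace ℝ (Fin N) → ℂ, x ∉ tsupport w → classicalGradient w x = 0 := by
      intro w hw
      by_contra h
      exact hw (support_classicalGradient_subset w h)
    change v x - F x = 0 ∧ classicalGradient v x - classicalGradient F x = 0
    rw [image_eq_zero_of_notMem_tsupport hxF, image_eq_zero_of_notMem_tsupport hxv, hg _ hxF,
      hg _ hxv]
    simp
  · intro x
    change ‖v x - F x‖ ≤ e ∧ ∀ i, ‖fderiv ℝ v x (EuclideanSpace.single i 1) -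
      fderiv ℝ F x (EuclideanSpace.single i 1)‖ ≤ e
    constructor
    · rw [← dist_eq_norm, dist_comm]
      refine φ.dist_normed_convolution_le hv.continuous.aestronglyMeasurable fun y hy => ?_
      exact (h₁ (lt_of_lt_of_le hy ((min_le_right _ _).trans (min_le_left _ _)))).le
    · intro i
      rw [← dist_eq_norm, dist_comm, hFg]
      refine φ.dist_normed_convolution_le
        (g := fun y => fderiv ℝ v y (EuclideanSpace.single i 1))
        (hcf' i).aestronglyMeasurable fun y hy => ?_
      exact (h₂ i _ _ (lt_of_lt_of_le hy ((min_le_right _ _).trans (min_le_right _ _)))).le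

theorem memH10_of_contDiff {N : ℕ} {Ω : TopologicalSpace.Opens (EuclideanSpace ℝ (Fin N))}
    {v : EuclideanSpace ℝ (Fin N) → ℂ} (hv : ContDiff ℝ 1 v) (hc : HasCompactSupport v)
    (hs : tsupport v ⊆ Ω) : MemH10 Ω v := by
  refine ⟨(hv.continuous.memLp_of_hasCompactSupport hc).restrict _, classicalGradient v,
    hasWeakGradient_of_contDiff Ω hv,
    ((continuous_classicalGradient hv).memLp_of_hasCompactSupport hc.classicalGradient).restrict _,
    fun ε hε => ?_⟩
  obtain ⟨K, hK, h⟩ := exists_testFunction_near hv hc hs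
  obtain ⟨c, hc0, hcK⟩ := ENNReal.exists_nnreal_pos_mul_lt
    (hK.measure_lt_top (μ := (volume : Measure (EuclideanSpace ℝ (Fin N))))).ne hε.ne'
  have hN : (0 : ℝ) < 1 + N := by positivity
  have hcr : (0 : ℝ) < c := hc0
  -- With this tolerance the `1 + N` squared differences add up to at most `c`, and `c |K| < ε`.
  obtain ⟨f, hf0, hf⟩ := h (Real.sqrt (c / (1 + N))) (Real.sqrt_pos.2 (by positivity))
  refine ⟨f, lt_of_le_of_lt ?_ hcK⟩
  calc ∫⁻ x in (Ω : Set (EuclideanSpace ℝ (Fin N))),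
        (‖v x - f x‖ₑ ^ 2 + ‖classicalGradient v x - classicalGradient f x‖ₑ ^ 2)
      ≤ ∫⁻ x, (‖v x - f x‖ₑ ^ 2 + ‖classicalGradient v x - classicalGradient f x‖ₑ ^ 2) :=
        setLIntegral_le_lintegral _ _
    _ ≤ ∫⁻ x, K.indicator (fun _ => (c : ℝ≥0∞)) x := by
        refine lintegral_mono fun x => ?_
        by_cases hx : x ∈ K
        · rw [indicator_of_mem hx]
          have h1 : ‖v x - f x‖ ^ 2 ≤ c / (1 + N) := by
            rw [← Real.sq_sqrt (show 0 ≤ (c : ℝ) / (1 + N) by positivity)]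
            exact pow_le_pow_left₀ (norm_nonneg _) (hf x).1 2
          have h2 : ‖classicalGradient v x - classicalGradient f x‖ ^ 2 ≤ N * (c / (1 + N)) := by
            rw [EuclideanSpace.norm_sq_eq]
            refine (Finset.sum_le_card_nsmul _ _ (c / (1 + N) : ℝ) fun i _ => ?_).trans (by simp)
            rw [← Real.sq_sqrt (show 0 ≤ (c : ℝ) / (1 + N) by positivity)]
            exact pow_le_pow_left₀ (norm_nonneg _) ((hf x).2 i) 2
          have h3 : ‖v x - f x‖ ^ 2 + ‖classicalGradient v x - classicalGradient f x‖ ^ 2 ≤ c := by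
            have : c / (1 + N : ℝ) + N * (c / (1 + N)) = c := by field_simp
            linarith
          rw [← ofReal_norm, ← ofReal_norm, ← ENNReal.ofReal_pow (norm_nonneg _),
            ← ENNReal.ofReal_pow (norm_nonneg _), ← ENNReal.ofReal_add (by positivity) (by positivity)]
          rw [← ENNReal.ofReal_coe_nnreal]
          exact ENNReal.ofReal_le_ofReal h3
        · rw [(hf0 x hx).1, (hf0 x hx).2]
          simp
    _ = c * volume K := by
        rw [lintegral_indicator hK.measurableSet, setLIntegral_const]

/-- Uniqueness of weak gradients transfers the approximation in the definition to any given `g`;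
passing to a subsequence adds convergence almost everywhere. -/
theorem MemH10.exists_seq {N : ℕ} {Ω : TopologicalSpace.Opens (EuclideanSpace ℝ (Fin N))}
    {u : EuclideanSpace ℝ (Fin N) → ℂ} {g : EuclideanSpace ℝ (Fin N) → EuclideanSpace ℂ (Fin N)}
    (hu : MemH10 Ω u) (hg : HasWeakGradient Ω u g) :
    MemLp g 2 (volume.restrict Ω) ∧ ∃ f : ℕ → TestFunction Ω ℂ ⊤,
      (∀ᵐ x ∂volume.restrict (Ω : Set (EuclideanSpace ℝ (Fin N))),
        Tendsto (fun n => f n x) atTop (𝓝 (u x))) ∧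
      Tendsto (fun n => eLpNorm (⇑(f n) - u) 2 (volume.restrict Ω)) atTop (𝓝 0) ∧
      Tendsto (fun n => eLpNorm (classicalGradient (f n) - g) 2 (volume.restrict Ω))
        atTop (𝓝 0) := by
  obtain ⟨hu2, g₀, hg₀, hg₀2, happ⟩ := hu
  have hgg : g =ᵐ[volume.restrict (Ω : Set (EuclideanSpace ℝ (Fin N)))] g₀ :=
    hg.ae_eq hg₀ (ae_eq_refl _)
  have hpos : ∀ n : ℕ, (0 : ℝ≥0∞) < (n + 1 : ℝ≥0∞)⁻¹ := fun n => by
    rw [ENNReal.inv_pos]; exact ENNReal.add_ne_top.2 ⟨ENNReal.natCast_ne_top n, ENNReal.one_ne_top⟩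
  choose f hf using fun n : ℕ => happ _ (hpos n)
  have hlim : Tendsto (fun n : ℕ => ((n + 1 : ℝ≥0∞)⁻¹) ^ (1 / (2 : ℝ))) atTop (𝓝 0) := by
    have h1 : Tendsto (fun n : ℕ => (n + 1 : ℝ≥0∞)⁻¹) atTop (𝓝 0) := by
      have := (tendsto_add_atTop_iff_nat 1).2 ENNReal.tendsto_inv_nat_nhds_zero
      simpa using this
    have h2 := (ENNReal.continuous_rpow_const (y := 1 / (2 : ℝ))).tendsto 0
    rw [ENNReal.zero_rpow_of_pos (by norm_num)] at h2
    exact h2.comp h1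
  have hU : Tendsto (fun n => eLpNorm (⇑(f n) - u) 2 (volume.restrict Ω)) atTop (𝓝 0) := by
    refine tendsto_of_tendsto_of_tendsto_of_le_of_le tendsto_const_nhds hlim (fun _ => zero_le)
      fun n => ?_
    simp only
    rw [eLpNorm_eq_lintegral_rpow_enorm_toReal (by simp) (by simp)]
    simp only [ENNReal.toReal_ofNat]
    refine ENNReal.rpow_le_rpow ((lintegral_mono fun x => ?_).trans (hf n).le) (by norm_num)
    rw [Pi.sub_apply, enorm_sub_rev, ENNReal.rpow_two]
    exact le_self_add
  have hG : Tendsto (fun n => eLpNorm (classicalGradient (f n) - g) 2 (volume.restrict Ω))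
      atTop (𝓝 0) := by
    refine tendsto_of_tendsto_of_tendsto_of_le_of_le tendsto_const_nhds hlim (fun _ => zero_le)
      fun n => ?_
    simp only
    rw [eLpNorm_eq_lintegral_rpow_enorm_toReal (by simp) (by simp)]
    simp only [ENNReal.toReal_ofNat]
    refine ENNReal.rpow_le_rpow ((lintegral_mono_ae ?_).trans (hf n).le) (by norm_num)
    filter_upwards [hgg] with x hx
    rw [Pi.sub_apply, enorm_sub_rev, ENNReal.rpow_two, hx]
    exact le_add_self
  obtain ⟨ns, hns, hae⟩ := (tendstoInMeasure_of_tendsto_eLpNorm (by simp)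
    (fun n => (f n).continuous.aestronglyMeasurable) hu2.1 hU).exists_seq_tendsto_ae
  exact ⟨hg₀2.ae_eq hgg.symm, fun n => f (ns n), hae, hU.comp hns.tendsto_atTop,
    hG.comp hns.tendsto_atTop⟩

/-! ### The chain rule for `C¹` maps with bounded derivative. -/

/-- The gradient of `F ∘ u` given by the chain rule, where `∇ u = g`. -/
noncomputable def chainGradient {N : ℕ} (F : ℂ → ℂ) (u : EuclideanSpace ℝ (Fin N) → ℂ)
    (g : EuclideanSpace ℝ (Fin N) → EuclideanSpace ℂ (Fin N)) (x : EuclideanSpace ℝ (Fin N)) :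
    EuclideanSpace ℂ (Fin N) :=
  WithLp.toLp 2 fun i => fderiv ℝ F (u x) (g x i)

theorem norm_chainGradient_le {N : ℕ} {F : ℂ → ℂ} {L : ℝ} (hL : ∀ z, ‖fderiv ℝ F z‖ ≤ L)
    (u : EuclideanSpace ℝ (Fin N) → ℂ) (g : EuclideanSpace ℝ (Fin N) → EuclideanSpace ℂ (Fin N))
    (x : EuclideanSpace ℝ (Fin N)) : ‖chainGradient F u g x‖ ≤ L * ‖g x‖ := by
  have hL0 : 0 ≤ L := (norm_nonneg _).trans (hL 0)
  rw [EuclideanSpace.norm_eq, EuclideanSpace.norm_eq, ← Real.sqrt_sq hL0, ← Real.sqrt_mul (sq_nonneg _),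
    Finset.mul_sum]
  refine Real.sqrt_le_sqrt (Finset.sum_le_sum fun i _ => ?_)
  rw [← mul_pow]
  exact pow_le_pow_left₀ (norm_nonneg _) ((fderiv ℝ F (u x)).le_of_opNorm_le (hL _) _) 2

theorem aestronglyMeasurable_chainGradient {N : ℕ} {F : ℂ → ℂ} (hF : ContDiff ℝ 1 F)
    {u : EuclideanSpace ℝ (Fin N) → ℂ} {g : EuclideanSpace ℝ (Fin N) → EuclideanSpace ℂ (Fin N)}
    {μ : Measure (EuclideanSpace ℝ (Fin N))} (hu : AEStronglyMeasurable u μ)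
    (hg : AEStronglyMeasurable g μ) : AEStronglyMeasurable (chainGradient F u g) μ := by
  have hc : Continuous fun p : ℂ × EuclideanSpace ℂ (Fin N) =>
      (WithLp.toLp 2 fun i => fderiv ℝ F p.1 (p.2 i) : EuclideanSpace ℂ (Fin N)) := by
    refine (PiLp.continuous_toLp 2 _).comp (continuous_pi fun i => ?_)
    exact ((hF.continuous_fderiv one_ne_zero).comp continuous_fst).clm_apply
      ((PiLp.continuous_apply 2 _ i).comp continuous_snd)
  exact hc.comp_aestronglyMeasurable (hu.prodMk hg)

theorem classicalGradient_comp {N : ℕ} {F : ℂ → ℂ} (hF : ContDiff ℝ 1 F)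
    {f : EuclideanSpace ℝ (Fin N) → ℂ} (hf : ContDiff ℝ 1 f) :
    classicalGradient (F ∘ f) = chainGradient F f (classicalGradient f) := by
  ext x i
  simp only [classicalGradient_apply, chainGradient]
  rw [fderiv_comp x (hF.differentiable one_ne_zero _) (hf.differentiable one_ne_zero _)]
  rfl

/-- The formula holds classically for `F ∘ f n` with `f n` test functions tending to `u`, and each
side passes to the limit. Since `F 0` may be nonzero, `F ∘ u` is only claimed to be locally
integrable. -/
theorem MemH10.hasWeakGradient_comp {N : ℕ} {Ω : TopologicalSpace.Opens (EuclideanSpace ℝ (Fin N))}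
    {u : EuclideanSpace ℝ (Fin N) → ℂ} {g : EuclideanSpace ℝ (Fin N) → EuclideanSpace ℂ (Fin N)}
    (hu : MemH10 Ω u) (hg : HasWeakGradient Ω u g) {F : ℂ → ℂ} (hF : ContDiff ℝ 1 F) {L : ℝ}
    (hL : ∀ z, ‖fderiv ℝ F z‖ ≤ L) :
    HasWeakGradient Ω (F ∘ u) (chainGradient F u g) := by
  have hL0 : 0 ≤ L := (norm_nonneg _).trans (hL 0)
  have hLip : ∀ z w, ‖F z - F w‖ ≤ L * ‖z - w‖ := fun z w =>
    convex_univ.norm_image_sub_le_of_norm_fderiv_le (𝕜 := ℝ)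
      (fun x _ => hF.differentiable one_ne_zero x) (fun x _ => hL x) (mem_univ _) (mem_univ _)
  obtain ⟨hg2, f, hae, hfu, hfg⟩ := hu.exists_seq hg
  have hlc : IsLocallyClosed (Ω : Set (EuclideanSpace ℝ (Fin N))) := Ω.isOpen.isLocallyClosed
  have hum : AEStronglyMeasurable u (volume.restrict Ω) := hu.1.1
  have hgm : AEStronglyMeasurable g (volume.restrict Ω) := hg2.1
  refine ⟨?_, ?_, ?_⟩
  · refine (locallyIntegrableOn_iff hlc).2 fun K hK hKc => ?_
    have h1 : IntegrableOn u K := hg.locallyIntegrableOn.integrableOn_compact_subset hK hKc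
    have h2 : IntegrableOn (fun _ => ‖F 0‖) K :=
      integrableOn_const (C := ‖F 0‖) hKc.measure_lt_top.ne
    refine Integrable.mono' (h2.add (h1.norm.const_mul L))
      (hF.continuous.comp_aestronglyMeasurable h1.1) (Eventually.of_forall fun x => ?_)
    have h3 := hLip (u x) 0
    rw [sub_zero] at h3
    have h4 := norm_sub_norm_le (F (u x)) (F 0)
    simp only [Pi.add_apply, Function.comp_apply]
    linarith
  · refine (locallyIntegrableOn_iff hlc).2 fun K hK hKc => ?_
    have h1 : IntegrableOn u K := hg.locallyIntegrableOn.integrableOn_compact_subset hK hKc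
    have h2 : IntegrableOn g K := hg.locallyIntegrableOn_grad.integrableOn_compact_subset hK hKc
    exact Integrable.mono' (h2.norm.const_mul L) (aestronglyMeasurable_chainGradient hF h1.1 h2.1)
      (Eventually.of_forall fun x => norm_chainGradient_le hL u g x)
  · intro η i
    have hfc : ∀ n, ContDiff ℝ 1 (f n) := fun n => (f n).contDiff.of_le (by norm_cast)
    have hη1 : ContDiff ℝ 1 η := η.contDiff.of_le (by norm_cast)
    have hηm : MemLp η 2 (volume.restrict Ω) :=
      (η.continuous.memLp_of_hasCompactSupport η.hasCompactSupport).restrict _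
    have hdη : MemLp (fun x => classicalGradient η x i) 2 (volume.restrict Ω) := by
      refine (Continuous.memLp_of_hasCompactSupport ?_ ?_).restrict _
      · exact (PiLp.continuous_apply 2 _ i).comp (continuous_classicalGradient hη1)
      · exact η.hasCompactSupport.fderiv_apply (𝕜 := ℝ) _
    have hgi : MemLp (fun x => g x i) 2 (volume.restrict Ω) := by
      refine MemLp.of_le hg2 ((PiLp.continuous_apply 2 _ i).comp_aestronglyMeasurable hgm)
        (Eventually.of_forall fun x => PiLp.norm_apply_le _ _)
    have hDm : ∀ {w : EuclideanSpace ℝ (Fin N) → ℂ} {k : EuclideanSpace ℝ (Fin N) → ℂ},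
        AEStronglyMeasurable w (volume.restrict Ω) → AEStronglyMeasurable k (volume.restrict Ω) →
        AEStronglyMeasurable (fun x => fderiv ℝ F (w x) (k x)) (volume.restrict Ω) := by
      intro w k hw hk
      exact (((hF.continuous_fderiv one_ne_zero).comp continuous_fst).clm_apply
        continuous_snd).comp_aestronglyMeasurable (hw.prodMk hk)
    have hfm : ∀ n, AEStronglyMeasurable (f n) (volume.restrict Ω) :=
      fun n => (f n).continuous.aestronglyMeasurable
    have hfgm : ∀ n, AEStronglyMeasurable (fun x => classicalGradient (f n) x i) (volume.restrict Ω) :=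
      fun n => ((PiLp.continuous_apply 2 _ i).comp
        (continuous_classicalGradient (hfc n))).aestronglyMeasurable
    -- the left-hand sides converge
    have hlhs : Tendsto (fun n => ∫ x in (Ω : Set (EuclideanSpace ℝ (Fin N))),
        F (f n x) * classicalGradient η x i) atTop
        (𝓝 (∫ x in (Ω : Set (EuclideanSpace ℝ (Fin N))), F (u x) * classicalGradient η x i)) := by
      refine tendsto_integral_of_L1' _ ((hF.continuous.comp_aestronglyMeasurable hum).mul hdη.1)
        (Eventually.of_forall fun n => ?_) ?_
      · refine (Continuous.integrable_of_hasCompactSupport ?_ ?_).restrict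
        · exact (hF.continuous.comp (f n).continuous).mul
            ((PiLp.continuous_apply 2 _ i).comp (continuous_classicalGradient hη1))
        · exact (η.hasCompactSupport.fderiv_apply (𝕜 := ℝ) _).mul_left
      · have hb : ∀ n, eLpNorm ((fun x => F (f n x) * classicalGradient η x i) -
            fun x => F (u x) * classicalGradient η x i) 1 (volume.restrict Ω) ≤
            ENNReal.ofReal L * eLpNorm (⇑(f n) - u) 2 (volume.restrict Ω) *
              eLpNorm (fun x => classicalGradient η x i) 2 (volume.restrict Ω) := by
          intro n
          have e : ((fun x => F (f n x) * classicalGradient η x i) -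
            fun x => F (u x) * classicalGradient η x i) = (fun x => F (f n x) - F (u x)) •
              (fun x => classicalGradient η x i) := by
            ext x; simp [sub_mul]
          rw [e]
          refine (eLpNorm_smul_le_mul_eLpNorm (p := 2) (q := 2) hdη.1
            ((hF.continuous.comp_aestronglyMeasurable (hfm n)).sub
              (hF.continuous.comp_aestronglyMeasurable hum))).trans ?_
          gcongr
          exact eLpNorm_le_mul_eLpNorm_of_ae_le_mul (Eventually.of_forall fun x => hLip _ _) 2
        refine tendsto_of_tendsto_of_tendsto_of_le_of_le tendsto_const_nhds ?_ (fun _ => zero_le) hb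
        have h1 := ENNReal.Tendsto.const_mul hfu (Or.inr (ENNReal.ofReal_ne_top (r := L)))
        have h2 := ENNReal.Tendsto.mul_const h1 (Or.inr hdη.2.ne)
        simpa using h2
    -- the right-hand sides converge
    have hrhs1 : Tendsto (fun n => ∫ x in (Ω : Set (EuclideanSpace ℝ (Fin N))),
        fderiv ℝ F (f n x) (g x i) * η x) atTop
        (𝓝 (∫ x in (Ω : Set (EuclideanSpace ℝ (Fin N))), fderiv ℝ F (u x) (g x i) * η x)) := by
      have hint : Integrable (fun x => L * (‖g x i‖ * ‖η x‖)) (volume.restrict Ω) :=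
        (hgi.norm.integrable_mul hηm.norm).const_mul L
      refine tendsto_integral_of_dominated_convergence _
        (fun n => (hDm (hfm n) hgi.1).mul hηm.1) hint
        (fun n => Eventually.of_forall fun x => ?_) ?_
      · rw [norm_mul, ← mul_assoc]
        gcongr
        exact (fderiv ℝ F (f n x)).le_of_opNorm_le (hL _) _
      · filter_upwards [hae] with x hx
        have hx' := ((hF.continuous_fderiv one_ne_zero).tendsto _).comp hx
        exact (((ContinuousLinearMap.apply ℝ ℂ (g x i)).continuous.tendsto _).comp hx').mul
          tendsto_const_nhds
    have hI : ∀ n, Integrable (fun x => fderiv ℝ F (f n x) (g x i) * η x) (volume.restrict Ω) := by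
      intro n
      have hint : Integrable (fun x => L * (‖g x i‖ * ‖η x‖)) (volume.restrict Ω) :=
        (hgi.norm.integrable_mul hηm.norm).const_mul L
      refine hint.mono' ((hDm (hfm n) hgi.1).mul hηm.1) (Eventually.of_forall fun x => ?_)
      rw [norm_mul, ← mul_assoc]
      gcongr
      exact (fderiv ℝ F (f n x)).le_of_opNorm_le (hL _) _
    have hI' : ∀ n, Integrable (fun x => fderiv ℝ F (f n x) (classicalGradient (f n) x i) * η x)
        (volume.restrict Ω) := by
      intro n
      refine (Continuous.integrable_of_hasCompactSupport ?_ η.hasCompactSupport.mul_left).restrict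
      exact (((hF.continuous_fderiv one_ne_zero).comp (f n).continuous).clm_apply
        ((PiLp.continuous_apply 2 _ i).comp (continuous_classicalGradient (hfc n)))).mul η.continuous
    have hrhs2 : Tendsto (fun n => ∫ x in (Ω : Set (EuclideanSpace ℝ (Fin N))),
        (fderiv ℝ F (f n x) (classicalGradient (f n) x i) * η x -
          fderiv ℝ F (f n x) (g x i) * η x)) atTop (𝓝 0) := by
      have h0 : (0 : ℂ) = ∫ x in (Ω : Set (EuclideanSpace ℝ (Fin N))), (0 : ℂ) := by simp
      rw [h0]
      refine tendsto_integral_of_L1' _ aestronglyMeasurable_const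
        (Eventually.of_forall fun n => (hI' n).sub (hI n)) ?_
      have hb : ∀ n, eLpNorm ((fun x => fderiv ℝ F (f n x) (classicalGradient (f n) x i) * η x -
          fderiv ℝ F (f n x) (g x i) * η x) - fun _ => 0) 1 (volume.restrict Ω) ≤
            ENNReal.ofReal L * eLpNorm (classicalGradient (f n) - g) 2 (volume.restrict Ω) *
              eLpNorm η 2 (volume.restrict Ω) := by
        intro n
        have e : ((fun x => fderiv ℝ F (f n x) (classicalGradient (f n) x i) * η x -
            fderiv ℝ F (f n x) (g x i) * η x) - fun _ => 0) =
            (fun x => fderiv ℝ F (f n x) (classicalGradient (f n) x i - g x i)) • ⇑η := by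
          ext x; simp [sub_mul]
        rw [e]
        refine (eLpNorm_smul_le_mul_eLpNorm (p := 2) (q := 2) hηm.1
          (hDm (hfm n) ((hfgm n).sub hgi.1))).trans ?_
        gcongr
        refine eLpNorm_le_mul_eLpNorm_of_ae_le_mul (Eventually.of_forall fun x => ?_) 2
        refine ((fderiv ℝ F (f n x)).le_of_opNorm_le (hL _) _).trans ?_
        gcongr
        exact PiLp.norm_apply_le (classicalGradient (f n) x - g x) i
      refine tendsto_of_tendsto_of_tendsto_of_le_of_le tendsto_const_nhds ?_ (fun _ => zero_le) hb
      have h1 := ENNReal.Tendsto.const_mul hfg (Or.inr (ENNReal.ofReal_ne_top (r := L)))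
      have h2 := ENNReal.Tendsto.mul_const h1 (Or.inr hηm.2.ne)
      simpa using h2
    have hsum := (hrhs2.add hrhs1).neg
    rw [zero_add] at hsum
    refine tendsto_nhds_unique hlhs (hsum.congr fun n => ?_)
    rw [integral_sub (hI' n) (hI n), sub_add_cancel]
    have := (hasWeakGradient_of_contDiff Ω (hF.comp (hfc n))).integral_eq η i
    rw [classicalGradient_comp hF (hfc n)] at this
    exact this.symm

/-! ### Algebra of the quadratic forms. -/

/-- The common factor `c` only contributes `|c|²`, and symmetry of `Im A` merges the two mixed terms
into one. In the applications `c` is `u` or a phase. -/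
theorem re_mulVec_dotProduct_star {N : ℕ} (A : Matrix (Fin N) (Fin N) ℂ)
    (hA : (A.map Complex.im)ᵀ = A.map Complex.im) (c : ℂ) (p q : Fin N → ℝ) (α β α' β' : ℝ) :
    ((A *ᵥ fun j => c * (α * p j + β * q j * Complex.I)) ⬝ᵥ
      star fun i => c * (α' * p i + β' * q i * Complex.I)).re =
    ‖c‖ ^ 2 * (α * α' * (A.map Complex.re *ᵥ p) ⬝ᵥ p + β * β' * (A.map Complex.re *ᵥ q) ⬝ᵥ q +
      (α * β' - α' * β) * (A.map Complex.im *ᵥ p) ⬝ᵥ q) := by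
  have hsym : ∀ i j, (A j i).im = (A i j).im := fun i j => by
    simpa using congrFun (congrFun hA i) j
  have hswap : ∑ i, ∑ j, (A i j).im * q j * p i = ∑ i, ∑ j, (A i j).im * p j * q i := by
    rw [Finset.sum_comm]
    refine Finset.sum_congr rfl fun i _ => Finset.sum_congr rfl fun j _ => ?_
    rw [hsym]; ring
  have hc : ‖c‖ ^ 2 = c.re * c.re + c.im * c.im := by rw [← Complex.normSq_apply, Complex.normSq_eq_norm_sq]
  have h : ((A *ᵥ fun j => c * (α * p j + β * q j * Complex.I)) ⬝ᵥ
      star fun i => c * (α' * p i + β' * q i * Complex.I)).re =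
      ‖c‖ ^ 2 * (α * α' * (∑ i, ∑ j, (A i j).re * p j * p i) +
        β * β' * (∑ i, ∑ j, (A i j).re * q j * q i) +
        (α * β' * (∑ i, ∑ j, (A i j).im * p j * q i) -
          α' * β * (∑ i, ∑ j, (A i j).im * q j * p i))) := by
    simp only [dotProduct, Matrix.mulVec, Finset.sum_mul, Complex.re_sum, Finset.mul_sum,
      ← Finset.sum_add_distrib, ← Finset.sum_sub_distrib]
    refine Finset.sum_congr rfl fun i _ => Finset.sum_congr rfl fun j _ => ?_
    simp only [Pi.star_apply, RCLike.star_def, map_mul, map_add, Complex.conj_ofReal,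
      Complex.conj_I, Complex.mul_re, Complex.mul_im, Complex.add_re, Complex.add_im,
      Complex.ofReal_re, Complex.ofReal_im, Complex.I_re, Complex.I_im, Complex.conj_re,
      Complex.conj_im, Complex.neg_re, Complex.neg_im]
    rw [hc]
    ring
  rw [h, hswap]
  simp only [dotProduct, Matrix.mulVec, Finset.sum_mul, Matrix.map_apply]
  ring

theorem mulVec_dotProduct_polarization {N : ℕ} (B : Matrix (Fin N) (Fin N) ℝ) (hB : Bᵀ = B)
    (p q : Fin N → ℝ) :
    4 * (B *ᵥ p) ⬝ᵥ q = quadForm B (p + q) - quadForm B (p - q) := by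
  have h : (B *ᵥ q) ⬝ᵥ p = (B *ᵥ p) ⬝ᵥ q := by
    rw [dotProduct_comm, Matrix.dotProduct_mulVec, ← Matrix.mulVec_transpose, hB]
  simp only [quadForm, Matrix.mulVec_add, Matrix.mulVec_sub, add_dotProduct, sub_dotProduct,
    dotProduct_add, dotProduct_sub, h]
  ring

theorem quadForm_add_add_quadForm_sub {N : ℕ} (B : Matrix (Fin N) (Fin N) ℝ) (p q : Fin N → ℝ) :
    quadForm B (p + q) + quadForm B (p - q) = 2 * quadForm B p + 2 * quadForm B q := by
  simp only [quadForm, Matrix.mulVec_add, Matrix.mulVec_sub, add_dotProduct, sub_dotProduct,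
    dotProduct_add, dotProduct_sub]
  ring

theorem quadForm_smul {N : ℕ} (B : Matrix (Fin N) (Fin N) ℝ) (t : ℝ) (p : Fin N → ℝ) :
    quadForm B (t • p) = t ^ 2 * quadForm B p := by
  simp only [quadForm, Matrix.mulVec_smul, smul_dotProduct, dotProduct_smul, smul_eq_mul]
  ring

/-- If `|σ| |⟨S ξ, ξ⟩| ≤ 2 √(a b) ⟨R ξ, ξ⟩` for all `ξ` and `S` is symmetric, then
`a ⟨R p, p⟩ + b ⟨R q, q⟩ + σ ⟨S p, q⟩ ≥ 0`. -/
theorem quadForm_add_nonneg {N : ℕ} {R S : Matrix (Fin N) (Fin N) ℝ} (hS : Sᵀ = S) {a b σ : ℝ}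
    (ha : 0 < a) (hb : 0 < b)
    (h : ∀ ξ, |σ| * |quadForm S ξ| ≤ 2 * Real.sqrt (b * a) * quadForm R ξ) (p q : Fin N → ℝ) :
    0 ≤ a * quadForm R p + b * quadForm R q + σ * (S *ᵥ p) ⬝ᵥ q := by
  -- After this rescaling both diagonal coefficients are equal, so the hypothesis at `p' + q'` and
  -- `p' - q'`, combined with polarization for `S` and the parallelogram law for `R`, gives the
  -- claim.
  set p' := Real.sqrt a • p with hp'
  set q' := Real.sqrt b • q with hq'
  have hsa : 0 < Real.sqrt a := Real.sqrt_pos.2 ha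
  have hsb : 0 < Real.sqrt b := Real.sqrt_pos.2 hb
  have h1 : quadForm R p' = a * quadForm R p := by rw [hp', quadForm_smul, Real.sq_sqrt ha.le]
  have h2 : quadForm R q' = b * quadForm R q := by rw [hq', quadForm_smul, Real.sq_sqrt hb.le]
  have h3 : (S *ᵥ p') ⬝ᵥ q' = Real.sqrt b * Real.sqrt a * (S *ᵥ p) ⬝ᵥ q := by
    simp only [hp', hq', Matrix.mulVec_smul, smul_dotProduct, dotProduct_smul, smul_eq_mul]
    ring
  have h4 := mulVec_dotProduct_polarization S hS p' q'
  have h5 := quadForm_add_add_quadForm_sub R p' q'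
  have k1 := h (p' + q')
  have k2 := h (p' - q')
  rw [Real.sqrt_mul hb.le] at k1 k2
  rw [← abs_mul] at k1 k2
  have k1' := neg_abs_le (σ * quadForm S (p' + q'))
  have k2' := le_abs_self (σ * quadForm S (p' - q'))
  set m := Real.sqrt b * Real.sqrt a with hm
  have hmp : 0 < m := by positivity
  have h6 : 0 ≤ m * (a * quadForm R p + b * quadForm R q + σ * (S *ᵥ p) ⬝ᵥ q) := by
    have e : m * (a * quadForm R p + b * quadForm R q + σ * (S *ᵥ p) ⬝ᵥ q) =
        m * (quadForm R p' + quadForm R q') + σ * (S *ᵥ p') ⬝ᵥ q' := by rw [h1, h2, h3]; ring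
    have e2 : 4 * (σ * (S *ᵥ p') ⬝ᵥ q') = σ * quadForm S (p' + q') - σ * quadForm S (p' - q') := by
      rw [← mul_sub, ← h4]; ring
    have e3 : 2 * m * quadForm R (p' + q') + 2 * m * quadForm R (p' - q') =
        4 * (m * (quadForm R p' + quadForm R q')) := by
      rw [← mul_add, h5]; ring
    rw [e]
    linarith
  exact (mul_nonneg_iff_of_pos_left hmp).1 h6

/-! ### Elementary properties of `s φ(s)`. -/

namespace IsAdmissible

variable {φ : ℝ → ℝ}

theorem differentiableAt (hφ : IsAdmissible φ) {s : ℝ} (hs : 0 < s) : DifferentiableAt ℝ φ s :=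
  (hφ.contDiffOn.differentiableOn one_ne_zero s hs).differentiableAt (Ioi_mem_nhds hs)

theorem contDiffAt (hφ : IsAdmissible φ) {s : ℝ} (hs : 0 < s) : ContDiffAt ℝ 1 φ s :=
  hφ.contDiffOn.contDiffAt (Ioi_mem_nhds hs)

theorem continuousOn_deriv (hφ : IsAdmissible φ) : ContinuousOn (deriv φ) (Ioi 0) :=
  hφ.contDiffOn.continuousOn_deriv_of_isOpen isOpen_Ioi le_rfl

theorem hasDerivAt_mul (hφ : IsAdmissible φ) {s : ℝ} (hs : 0 < s) :
    HasDerivAt (fun σ => σ * φ σ) (φ s + s * deriv φ s) s := by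
  simpa using (hasDerivAt_id' s).fun_mul (hφ.differentiableAt hs).hasDerivAt

theorem deriv_mul (hφ : IsAdmissible φ) {s : ℝ} (hs : 0 < s) :
    deriv (fun σ => σ * φ σ) s = φ s + s * deriv φ s :=
  (hφ.hasDerivAt_mul hs).deriv

theorem continuousOn_deriv_mul (hφ : IsAdmissible φ) :
    ContinuousOn (deriv fun σ => σ * φ σ) (Ioi 0) :=
  (hφ.contDiffOn.continuousOn.add (continuousOn_id.mul hφ.continuousOn_deriv)).congr
    fun _ hs => hφ.deriv_mul hs

theorem strictMonoOn (hφ : IsAdmissible φ) : StrictMonoOn (fun s => s * φ s) (Ioi 0) := by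
  refine strictMonoOn_of_deriv_pos (convex_Ioi 0)
    (fun s hs => (hφ.hasDerivAt_mul hs).continuousAt.continuousWithinAt) fun s hs => ?_
  rw [interior_Ioi] at hs
  exact hφ.deriv_pos s hs

theorem exists_mul_eq (hφ : IsAdmissible φ) {t : ℝ} (ht : 0 < t) : ∃ s, 0 < s ∧ s * φ s = t := by
  have : t ∈ (fun s => s * φ s) '' Ioi 0 := by rw [hφ.range_eq]; exact ht
  exact this

theorem mul_pos' (hφ : IsAdmissible φ) {s : ℝ} (hs : 0 < s) : 0 < s * φ s :=
  mul_pos hs (hφ.pos s hs)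

/-- An increasing function on `(0, ∞)` taking arbitrarily small positive values tends to zero; the
growth condition near the origin plays no role. -/
theorem tendsto_mul (hφ : IsAdmissible φ) : Tendsto (fun s => s * φ s) (𝓝[>] 0) (𝓝 0) := by
  refine Metric.tendsto_nhds.2 fun ε hε => ?_
  obtain ⟨δ, hδ, h⟩ := hφ.exists_mul_eq hε
  filter_upwards [Ioo_mem_nhdsGT hδ] with s hs
  rw [Real.dist_eq, sub_zero, abs_of_pos (hφ.mul_pos' hs.1), ← h]
  exact hφ.strictMonoOn hs.1 hδ hs.2

end IsAdmissible

/-! ### The weak gradient of `u` on its zero set, and the weak gradient of `φ(|u|) u`. -/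

/-- The map `z ↦ χ(z) z`, where `χ` is a bump function. -/
noncomputable def bumpId (χ : ContDiffBump (0 : ℂ)) (z : ℂ) : ℂ := (χ z : ℂ) * z

theorem contDiff_bumpId (χ : ContDiffBump (0 : ℂ)) {n : ℕ∞} : ContDiff ℝ n (bumpId χ) :=
  (Complex.ofRealCLM.contDiff.comp χ.contDiff).mul contDiff_id

theorem hasCompactSupport_bumpId (χ : ContDiffBump (0 : ℂ)) : HasCompactSupport (bumpId χ) :=
  (χ.hasCompactSupport.comp_left (g := fun t : ℝ => (t : ℂ)) (by simp)).mul_right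

theorem bumpId_of_rOut_le {χ : ContDiffBump (0 : ℂ)} {z : ℂ} (hz : χ.rOut ≤ ‖z‖) : bumpId χ z = 0 := by
  rw [bumpId, χ.zero_of_le_dist (by simpa using hz)]; simp

theorem bumpId_of_le_rIn {χ : ContDiffBump (0 : ℂ)} {z : ℂ} (hz : ‖z‖ ≤ χ.rIn) : bumpId χ z = z := by
  rw [bumpId, χ.one_of_mem_closedBall (by simpa using hz)]; simp

theorem exists_norm_fderiv_le {F : ℂ → ℂ} (hF : ContDiff ℝ 1 F) (hc : HasCompactSupport F) :
    ∃ L, ∀ z, ‖fderiv ℝ F z‖ ≤ L :=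
  (hF.continuous_fderiv one_ne_zero).bounded_above_of_compact_support (hc.fderiv (𝕜 := ℝ))

/-- The weak gradient of `u` vanishes almost everywhere on `{u = 0}`. -/
theorem MemH10.ae_eq_zero_of_eq_zero {N : ℕ}
    {Ω : TopologicalSpace.Opens (EuclideanSpace ℝ (Fin N))}
    {u : EuclideanSpace ℝ (Fin N) → ℂ} {g : EuclideanSpace ℝ (Fin N) → EuclideanSpace ℂ (Fin N)}
    (hu : MemH10 Ω u) (hg : HasWeakGradient Ω u g) :
    ∀ᵐ x ∂volume.restrict (Ω : Set (EuclideanSpace ℝ (Fin N))), u x = 0 → g x = 0 := by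
  classical
  let χ : ContDiffBump (0 : ℂ) := ⟨1, 2, one_pos, one_lt_two⟩
  have hF : ContDiff ℝ 1 (bumpId χ) := contDiff_bumpId χ (n := 1)
  obtain ⟨L, hL⟩ := exists_norm_fderiv_le hF (hasCompactSupport_bumpId χ)
  have hL0 : 0 ≤ L := (norm_nonneg _).trans (hL 0)
  obtain ⟨B, hB⟩ := hF.continuous.bounded_above_of_compact_support (hasCompactSupport_bumpId χ)
  obtain ⟨hg2, -⟩ := hu.exists_seq hg
  have hF0 : fderiv ℝ (bumpId χ) 0 = ContinuousLinearMap.id ℝ ℂ := by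
    have : bumpId χ =ᶠ[𝓝 0] id := by
      filter_upwards [Metric.ball_mem_nhds (0 : ℂ) one_pos] with z hz
      exact bumpId_of_le_rIn (mem_ball_zero_iff.1 hz).le
    rw [this.fderiv_eq, fderiv_id]
  have hFz : ∀ z : ℂ, 2 < ‖z‖ → fderiv ℝ (bumpId χ) z = 0 := by
    intro z hz
    have : bumpId χ =ᶠ[𝓝 z] fun _ => 0 := by
      filter_upwards [(isOpen_lt continuous_const continuous_norm).mem_nhds hz] with w hw
      exact bumpId_of_rOut_le (le_of_lt hw)
    rw [this.fderiv_eq]; simp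
  -- These functions tend to zero uniformly, with uniformly bounded derivatives tending to the
  -- identity at `0` and to zero elsewhere. In the limit of the chain rule, `G = 1_{u = 0} g` is a
  -- weak gradient of the zero function.
  let F : ℕ → ℂ → ℂ := fun n z => ((n + 1 : ℝ)⁻¹ : ℝ) • bumpId χ ((n + 1 : ℝ) • z)
  have hFn : ∀ n, ContDiff ℝ 1 (F n) := fun n =>
    (hF.comp (contDiff_id.const_smul (n + 1 : ℝ))).const_smul ((n + 1 : ℝ)⁻¹)
  have hFd : ∀ n z, fderiv ℝ (F n) z = fderiv ℝ (bumpId χ) ((n + 1 : ℝ) • z) := by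
    intro n z
    have hn : (n + 1 : ℝ) ≠ 0 := by positivity
    have h1 : HasFDerivAt (fun w : ℂ => (n + 1 : ℝ) • w) ((n + 1 : ℝ) • ContinuousLinearMap.id ℝ ℂ) z :=
      (hasFDerivAt_id z).fun_const_smul _
    have h2 := (((hF.differentiable one_ne_zero _).hasFDerivAt.comp z h1).const_smul
      ((n + 1 : ℝ)⁻¹)).fderiv
    refine h2.trans ?_
    ext w
    all_goals simp [hn]
  have hum : AEStronglyMeasurable u (volume.restrict Ω) := hu.1.1
  let G : EuclideanSpace ℝ (Fin N) → EuclideanSpace ℂ (Fin N) := fun x => if u x = 0 then g x else 0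
  have hptw : ∀ x i, Tendsto (fun n : ℕ => fderiv ℝ (F n) (u x) (g x i)) atTop (𝓝 (G x i)) := by
    intro x i
    by_cases hx : u x = 0
    · simp [G, hx, hFd, hF0]
    · simp only [G, hx, if_false]
      refine tendsto_const_nhds.congr' ?_
      have hx' : 0 < ‖u x‖ := norm_pos_iff.2 hx
      obtain ⟨n₀, hn₀⟩ := exists_nat_gt (2 / ‖u x‖)
      filter_upwards [eventually_ge_atTop n₀] with n hn
      rw [hFd, hFz]
      · simp
      · rw [norm_smul, Real.norm_of_nonneg (by positivity)]
        rw [div_lt_iff₀ hx'] at hn₀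
        have : (n₀ : ℝ) ≤ n := by exact_mod_cast hn
        nlinarith
  have hGm : AEStronglyMeasurable G (volume.restrict Ω) := by
    refine aestronglyMeasurable_of_tendsto_ae atTop
      (f := fun n => chainGradient (F n) u g)
      (fun n => aestronglyMeasurable_chainGradient (hFn n) hum hg2.1)
      (Eventually.of_forall fun x => ?_)
    exact ((PiLp.continuous_toLp 2 _).tendsto _).comp (tendsto_pi_nhds.2 fun i => hptw x i)
  have hGle : ∀ x, ‖G x‖ ≤ ‖g x‖ := fun x => by
    by_cases hx : u x = 0 <;> simp [G, hx]
  have hlc : IsLocallyClosed (Ω : Set (EuclideanSpace ℝ (Fin N))) := Ω.isOpen.isLocallyClosed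
  have hG : HasWeakGradient Ω (fun _ => 0) G := by
    refine ⟨(locallyIntegrable_const 0).locallyIntegrableOn _, ?_, ?_⟩
    · refine (locallyIntegrableOn_iff hlc).2 fun K hK hKc => ?_
      have h2 : IntegrableOn g K := hg.locallyIntegrableOn_grad.integrableOn_compact_subset hK hKc
      exact Integrable.mono h2 (hGm.mono_measure (Measure.restrict_mono hK le_rfl))
        (Eventually.of_forall hGle)
    · intro η i
      have hη1 : ContDiff ℝ 1 η := η.contDiff.of_le (by norm_cast)
      have hηm : MemLp η 2 (volume.restrict Ω) :=
        (η.continuous.memLp_of_hasCompactSupport η.hasCompactSupport).restrict _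
      have hgi : MemLp (fun x => g x i) 2 (volume.restrict Ω) :=
        MemLp.of_le hg2 ((PiLp.continuous_apply 2 _ i).comp_aestronglyMeasurable hg2.1)
          (Eventually.of_forall fun x => PiLp.norm_apply_le _ _)
      have hdη : Integrable (fun x => classicalGradient η x i) (volume.restrict Ω) := by
        refine (Continuous.integrable_of_hasCompactSupport ?_ ?_).restrict
        · exact (PiLp.continuous_apply 2 _ i).comp (continuous_classicalGradient hη1)
        · exact η.hasCompactSupport.fderiv_apply (𝕜 := ℝ) _
      have hFL : ∀ n z, ‖fderiv ℝ (F n) z‖ ≤ L := fun n z => by rw [hFd]; exact hL _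
      have hw := fun n => (hu.hasWeakGradient_comp hg (hFn n) (hFL n)).integral_eq η i
      have hr : Tendsto (fun n => ∫ x in (Ω : Set (EuclideanSpace ℝ (Fin N))),
          chainGradient (F n) u g x i * η x) atTop
          (𝓝 (∫ x in (Ω : Set (EuclideanSpace ℝ (Fin N))), G x i * η x)) := by
        refine tendsto_integral_of_dominated_convergence (fun x => L * (‖g x i‖ * ‖η x‖))
          (fun n => ?_) ((hgi.norm.integrable_mul hηm.norm).const_mul L)
          (fun n => Eventually.of_forall fun x => ?_)
          (Eventually.of_forall fun x => (hptw x i).mul tendsto_const_nhds)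
        · exact ((PiLp.continuous_apply 2 _ i).comp_aestronglyMeasurable
            (aestronglyMeasurable_chainGradient (hFn n) hum hg2.1)).mul hηm.1
        · rw [norm_mul, ← mul_assoc]
          gcongr
          exact (fderiv ℝ (F n) (u x)).le_of_opNorm_le (hFL n _) _
      have hB0 : 0 ≤ B := (norm_nonneg _).trans (hB 0)
      have hl : Tendsto (fun n => ∫ x in (Ω : Set (EuclideanSpace ℝ (Fin N))),
          (F n ∘ u) x * classicalGradient η x i) atTop
          (𝓝 (∫ x in (Ω : Set (EuclideanSpace ℝ (Fin N))), (0 : ℂ) * classicalGradient η x i)) := by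
        have hFB : ∀ n z, ‖F n z‖ ≤ (n + 1 : ℝ)⁻¹ * B := fun n z => by
          simp only [F, norm_smul]
          rw [Real.norm_of_nonneg (by positivity)]
          gcongr
          exact hB _
        refine tendsto_integral_of_dominated_convergence
          (fun x => B * ‖classicalGradient η x i‖) (fun n => ?_) (hdη.norm.const_mul B)
          (fun n => Eventually.of_forall fun x => ?_)
          (Eventually.of_forall fun x => Tendsto.mul_const _ ?_)
        · exact ((hFn n).continuous.comp_aestronglyMeasurable hum).mul hdη.1
        · rw [norm_mul]
          gcongr
          refine (hFB n _).trans ?_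
          have : (n + 1 : ℝ)⁻¹ ≤ 1 := inv_le_one_of_one_le₀ (by linarith [n.cast_nonneg (α := ℝ)])
          nlinarith
        · refine squeeze_zero_norm (fun n => hFB n _) ?_
          have := (tendsto_one_div_add_atTop_nhds_zero_nat (𝕜 := ℝ)).mul_const B
          simpa using this
      refine tendsto_nhds_unique hl ?_
      exact hr.neg.congr fun n => (hw n).symm
  have hz : HasWeakGradient Ω (fun _ => (0 : ℂ)) (fun _ => 0) := by
    refine ⟨(locallyIntegrable_const 0).locallyIntegrableOn _,
      (locallyIntegrable_const 0).locallyIntegrableOn _, by simp⟩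
  filter_upwards [hG.ae_eq hz (ae_eq_refl _)] with x hx hux
  simpa [G, hux] using hx

/-- The map `z ↦ φ(|z|) z`. -/
noncomputable def radialMap (φ : ℝ → ℝ) (z : ℂ) : ℂ := (φ ‖z‖ : ℂ) * z

namespace IsAdmissible

variable {φ : ℝ → ℝ}

theorem norm_radialMap (hφ : IsAdmissible φ) {z : ℂ} (hz : z ≠ 0) :
    ‖radialMap φ z‖ = ‖z‖ * φ ‖z‖ := by
  rw [radialMap, norm_mul, Complex.norm_real, Real.norm_of_nonneg (hφ.pos _ (norm_pos_iff.2 hz)).le,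
    mul_comm]

theorem contDiffAt_radialMap (hφ : IsAdmissible φ) {z : ℂ} (hz : z ≠ 0) :
    ContDiffAt ℝ 1 (radialMap φ) z := by
  have h1 : ContDiffAt ℝ 1 (fun z : ℂ => φ ‖z‖) z :=
    ContDiffAt.comp z (hφ.contDiffAt (norm_pos_iff.2 hz)) (contDiffAt_norm ℝ hz)
  exact (Complex.ofRealCLM.contDiff.contDiffAt.comp z h1).mul contDiffAt_id

/-- Differentiate along the logarithmic spiral `t ↦ z exp(t (a + b i))`: its modulus is `|z| exp(t
a)`, so only one-variable calculus is needed. -/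
theorem fderiv_radialMap (hφ : IsAdmissible φ) {z : ℂ} (hz : z ≠ 0) (a b : ℝ) :
    fderiv ℝ (radialMap φ) z (z * (a + b * Complex.I)) =
      z * (deriv (fun σ => σ * φ σ) ‖z‖ * a + φ ‖z‖ * b * Complex.I) := by
  have hz' : 0 < ‖z‖ := norm_pos_iff.2 hz
  set w : ℂ := a + b * Complex.I with hw
  have hcurve : HasDerivAt (fun t : ℝ => z * Complex.exp (t * w)) (z * w) 0 := by
    have h0 : HasDerivAt (fun t : ℝ => (t : ℂ) * w) w 0 := by
      simpa using (Complex.ofRealCLM.hasDerivAt (x := (0 : ℝ))).mul_const w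
    have h1 := h0.cexp.const_mul z
    simpa using h1
  have hd := ((hφ.contDiffAt_radialMap hz).differentiableAt one_ne_zero).hasFDerivAt
  have h1 : HasDerivAt (fun t : ℝ => radialMap φ (z * Complex.exp (t * w)))
      (fderiv ℝ (radialMap φ) z (z * w)) 0 := by
    have hd' : HasFDerivAt (radialMap φ) (fderiv ℝ (radialMap φ) z) (z * Complex.exp ((0 : ℝ) * w)) := by
      simpa using hd
    exact hd'.comp_hasDerivAt 0 hcurve
  have hnorm : ∀ t : ℝ, ‖z * Complex.exp (t * w)‖ = ‖z‖ * Real.exp (t * a) := by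
    intro t
    rw [norm_mul, Complex.norm_exp]
    simp [hw]
  have h2 : HasDerivAt (fun t : ℝ => radialMap φ (z * Complex.exp (t * w)))
      (z * (deriv (fun σ => σ * φ σ) ‖z‖ * a + φ ‖z‖ * b * Complex.I)) 0 := by
    have e1 : HasDerivAt (fun t : ℝ => ‖z‖ * Real.exp (t * a)) (‖z‖ * a) 0 := by
      have : HasDerivAt (fun t : ℝ => t * a) a 0 := by simpa using (hasDerivAt_id' (0 : ℝ)).mul_const a
      simpa using this.exp.const_mul ‖z‖
    have e2 : HasDerivAt (fun t : ℝ => φ (‖z‖ * Real.exp (t * a))) (deriv φ ‖z‖ * (‖z‖ * a)) 0 := by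
      have hd' : HasDerivAt φ (deriv φ ‖z‖) (‖z‖ * Real.exp (0 * a)) := by
        simpa using (hφ.differentiableAt hz').hasDerivAt
      exact hd'.comp 0 e1
    have e3 := (e2.ofReal_comp.mul hcurve)
    refine (e3.congr_deriv ?_).congr_of_eventuallyEq (Eventually.of_forall fun t => ?_)
    · rw [hφ.deriv_mul hz', hw]
      simp
      ring
    · simp only [radialMap, hnorm, Pi.mul_apply]
  exact h1.unique h2

/-- `radialMap φ` is continuous at `0`, where it may fail to be differentiable, but `P` vanishes
near its value there. Its modulus increases to infinity with `|z|`, which gives compact support. -/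
theorem contDiff_comp_radialMap (hφ : IsAdmissible φ) {P : ℂ → ℂ} (hP : ContDiff ℝ 1 P)
    (hc : HasCompactSupport P) (h0 : P =ᶠ[𝓝 0] 0) :
    ContDiff ℝ 1 (P ∘ radialMap φ) ∧ HasCompactSupport (P ∘ radialMap φ) := by
  constructor
  · rw [contDiff_iff_contDiffAt]
    intro z
    by_cases hz : z = 0
    · subst hz
      have hT : Tendsto (radialMap φ) (𝓝 0) (𝓝 0) := by
        rw [tendsto_zero_iff_norm_tendsto_zero, ← nhdsNE_sup_pure]
        refine Tendsto.sup ?_ ?_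
        · have : Tendsto (fun z : ℂ => ‖z‖) (𝓝[≠] 0) (𝓝[>] 0) := tendsto_norm_nhdsNE_zero
          refine (hφ.tendsto_mul.comp this).congr' ?_
          filter_upwards [self_mem_nhdsWithin] with z hz
          exact (hφ.norm_radialMap hz).symm
        · rw [tendsto_pure_left]
          intro s hs
          simpa [radialMap] using mem_of_mem_nhds hs
      have : P ∘ radialMap φ =ᶠ[𝓝 0] fun _ => 0 := hT.eventually h0
      exact contDiffAt_const.congr_of_eventuallyEq this
    · exact hP.contDiffAt.comp z (hφ.contDiffAt_radialMap hz)
  · obtain ⟨R, hR, hRP⟩ := hc.exists_pos_le_norm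
    obtain ⟨s, hs, hsR⟩ := hφ.exists_mul_eq hR
    refine HasCompactSupport.of_support_subset_isCompact (isCompact_closedBall (0 : ℂ) s) ?_
    intro z hz
    by_contra h
    apply hz
    have hz' : s < ‖z‖ := by simpa using h
    refine hRP _ ?_
    rw [hφ.norm_radialMap (norm_pos_iff.1 (hs.trans hz')), ← hsR]
    exact (hφ.strictMonoOn hs (hs.trans hz') hz').le

/-- The chain rule for `φ(|u|) u` on the set `{u ≠ 0}`. -/
theorem ae_weakGradient_phiMul (hφ : IsAdmissible φ) {N : ℕ}
    {Ω : TopologicalSpace.Opens (EuclideanSpace ℝ (Fin N))}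
    {u : EuclideanSpace ℝ (Fin N) → ℂ} {g h : EuclideanSpace ℝ (Fin N) → EuclideanSpace ℂ (Fin N)}
    (hu : MemH10 Ω u) (hv : MemH10 Ω (phiMul φ u)) (hg : HasWeakGradient Ω u g)
    (hh : HasWeakGradient Ω (phiMul φ u) h) :
    ∀ᵐ x ∂volume.restrict (Ω : Set (EuclideanSpace ℝ (Fin N))), u x ≠ 0 →
      h x = chainGradient (radialMap φ) u g x := by
  have hn : ∀ n : ℕ, ∀ᵐ x ∂volume.restrict (Ω : Set (EuclideanSpace ℝ (Fin N))),
      ‖radialMap φ (u x)‖ < n + 1 → (n + 1 : ℝ)⁻¹ < ‖radialMap φ (u x)‖ → u x ≠ 0 →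
      h x = chainGradient (radialMap φ) u g x := by
    intro n
    have hn0 : (0 : ℝ) < n + 1 := by positivity
    let χ₁ : ContDiffBump (0 : ℂ) := ⟨n + 1, n + 2, hn0, by linarith⟩
    let χ₂ : ContDiffBump (0 : ℂ) := ⟨(n + 1 : ℝ)⁻¹ / 2, (n + 1 : ℝ)⁻¹, by positivity,
      half_lt_self (by positivity)⟩
    have hin : (n + 1 : ℝ)⁻¹ ≤ n + 1 :=
      (inv_le_one_of_one_le₀ (by linarith [n.cast_nonneg (α := ℝ)])).trans
        (by linarith [n.cast_nonneg (α := ℝ)])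
    -- `P` vanishes near `0` and is the identity for `1/(n+1) < |z| < n+1`. The function `P(φ(|u|)
    -- u)` is both `P ∘ phiMul φ u` and `(P ∘ radialMap φ) ∘ u`; the bounded chain rule applies to
    -- each, and uniqueness compares the results. The annuli exhaust `ℂ ∖ {0}`.
    let P : ℂ → ℂ := fun z => bumpId χ₁ z - bumpId χ₂ z
    have hP : ContDiff ℝ 1 P := (contDiff_bumpId χ₁ (n := 1)).sub (contDiff_bumpId χ₂ (n := 1))
    have hPc : HasCompactSupport P := (hasCompactSupport_bumpId χ₁).sub (hasCompactSupport_bumpId χ₂)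
    have hP0 : P =ᶠ[𝓝 0] 0 := by
      filter_upwards [Metric.ball_mem_nhds (0 : ℂ) χ₂.rIn_pos] with z hz
      have hz' := (mem_ball_zero_iff.1 hz).le
      simp only [P, Pi.zero_apply]
      rw [bumpId_of_le_rIn hz', bumpId_of_le_rIn ((hz'.trans χ₂.rIn_lt_rOut.le).trans hin), sub_self]
    have hPid : ∀ z : ℂ, ‖z‖ < n + 1 → (n + 1 : ℝ)⁻¹ < ‖z‖ → P =ᶠ[𝓝 z] id := by
      intro z h1 h2
      filter_upwards [(isOpen_lt continuous_norm continuous_const).mem_nhds h1,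
        (isOpen_lt continuous_const continuous_norm).mem_nhds h2] with w hw1 hw2
      simp only [P, id]
      rw [bumpId_of_le_rIn (le_of_lt hw1), bumpId_of_rOut_le (le_of_lt hw2), sub_zero]
    obtain ⟨hQ, hQc⟩ := hφ.contDiff_comp_radialMap hP hPc hP0
    obtain ⟨L₁, hL₁⟩ := exists_norm_fderiv_le hP hPc
    obtain ⟨L₂, hL₂⟩ := exists_norm_fderiv_le hQ hQc
    have w₁ := hv.hasWeakGradient_comp hh hP hL₁
    have w₂ := hu.hasWeakGradient_comp hg hQ hL₂
    filter_upwards [w₁.ae_eq w₂ (ae_eq_refl _)] with x hx h1 h2 h3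
    ext i
    have hxi := congrFun (congrArg WithLp.ofLp hx) i
    simp only [chainGradient] at hxi ⊢
    have e1 : P =ᶠ[𝓝 (radialMap φ (u x))] id := hPid _ h1 h2
    have e2 : P ∘ radialMap φ =ᶠ[𝓝 (u x)] radialMap φ :=
      (hφ.contDiffAt_radialMap h3).continuousAt.eventually e1
    have e3 : fderiv ℝ P (phiMul φ u x) = ContinuousLinearMap.id ℝ ℂ := by
      have : P =ᶠ[𝓝 (phiMul φ u x)] id := e1
      rw [this.fderiv_eq, fderiv_id]
    rw [e3, e2.fderiv_eq] at hxi
    exact hxi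
  filter_upwards [ae_all_iff.2 hn] with x hx hux
  have hpos : 0 < ‖radialMap φ (u x)‖ := by
    rw [hφ.norm_radialMap hux]
    exact hφ.mul_pos' (norm_pos_iff.2 hux)
  obtain ⟨n₁, hn₁⟩ := exists_nat_gt ‖radialMap φ (u x)‖
  obtain ⟨n₂, hn₂⟩ := exists_nat_gt ‖radialMap φ (u x)‖⁻¹
  refine hx (max n₁ n₂) ?_ ?_ hux
  · have : (n₁ : ℝ) ≤ (max n₁ n₂ : ℕ) := by exact_mod_cast le_max_left _ _
    linarith
  · rw [inv_lt_comm₀ (by positivity) hpos]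
    have : (n₂ : ℝ) ≤ (max n₁ n₂ : ℕ) := by exact_mod_cast le_max_right _ _
    linarith

/-! ### Sufficiency of the algebraic condition. -/

theorem isFunctionalDissipative_of_forall_le (hφ : IsAdmissible φ) {N : ℕ}
    {Ω : TopologicalSpace.Opens (EuclideanSpace ℝ (Fin N))}
    {A : EuclideanSpace ℝ (Fin N) → Matrix (Fin N) (Fin N) ℂ}
    (hsymm : ∀ᵐ x ∂volume.restrict (Ω : Set (EuclideanSpace ℝ (Fin N))),
      ((A x).map Complex.im)ᵀ = (A x).map Complex.im)
    (hle : ∀ᵐ x ∂volume.restrict (Ω : Set (EuclideanSpace ℝ (Fin N))),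
        ∀ s : ℝ, 0 < s → ∀ ξ : Fin N → ℝ,
          |s * deriv φ s| * |quadForm ((A x).map Complex.im) ξ| ≤
            2 * Real.sqrt (φ s * deriv (fun σ => σ * φ σ) s) *
              quadForm ((A x).map Complex.re) ξ) :
    IsFunctionalDissipative Ω A φ := by
  intro u hu hv g h hg hh
  -- The integral of a non-integrable function is zero by convention, so that case is trivial and no
  -- bound on `A` has to be invoked.
  by_cases hint : Integrable (fun x => (A x *ᵥ (g x).ofLp) ⬝ᵥ star (h x).ofLp) (volume.restrict Ω)
  swap
  · rw [gradForm, integral_undef hint]; simp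
  have hre : (gradForm Ω A g h).re = ∫ x in (Ω : Set (EuclideanSpace ℝ (Fin N))),
      ((A x *ᵥ (g x).ofLp) ⬝ᵥ star (h x).ofLp).re := by
    have := integral_re (𝕜 := ℂ) hint
    exact this.symm
  rw [hre]
  refine integral_nonneg_of_ae ?_
  filter_upwards [hsymm, hle, hu.ae_eq_zero_of_eq_zero hg, hφ.ae_weakGradient_phiMul hu hv hg hh]
    with x hs hx h0 hch
  by_cases hux : u x = 0
  · simp [h0 hux]
  · have hux' : 0 < ‖u x‖ := norm_pos_iff.2 hux
    -- Dividing by `u` separates the radial part `p` of the gradient from its angular part `q`.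
    let p : Fin N → ℝ := fun i => (g x i / u x).re
    let q : Fin N → ℝ := fun i => (g x i / u x).im
    have hgi : ∀ i, g x i = u x * (p i + q i * Complex.I) := fun i => by
      simp only [p, q]
      rw [Complex.re_add_im, mul_div_cancel₀ _ hux]
    have hgx : (g x).ofLp = fun j => u x * (((1 : ℝ) : ℂ) * p j + ((1 : ℝ) : ℂ) * q j * Complex.I) := by
      funext j
      rw [hgi]; simp
    have hhx : (h x).ofLp = fun i => u x * ((deriv (fun σ => σ * φ σ) ‖u x‖ : ℝ) * p i +
        (φ ‖u x‖ : ℝ) * q i * Complex.I) := by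
      funext i
      rw [hch hux]
      simp only [chainGradient]
      rw [hgi, hφ.fderiv_radialMap hux]
    simp only [Pi.zero_apply]
    rw [hgx, hhx, re_mulVec_dotProduct_star _ hs]
    have hq := quadForm_add_nonneg (R := (A x).map Complex.re) hs
      (hφ.deriv_pos _ hux') (hφ.pos _ hux') (σ := φ ‖u x‖ - deriv (fun σ => σ * φ σ) ‖u x‖)
      (by
        intro ξ
        have : φ ‖u x‖ - deriv (fun σ => σ * φ σ) ‖u x‖ = -(‖u x‖ * deriv φ ‖u x‖) := by
          rw [hφ.deriv_mul hux']; ring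
        rw [this, abs_neg]
        exact hx _ hux' ξ) p q
    refine mul_nonneg (sq_nonneg _) ?_
    simpa [quadForm] using hq

end IsAdmissible

/-! ### Necessity: test functions in polar form. -/

/-- The function `t ↦ tᵐ φ(tᵐ)` on `(0, ∞)`, extended by zero. -/
noncomputable def powMul (φ : ℝ → ℝ) (m : ℕ) (t : ℝ) : ℝ :=
  if 0 < t then t ^ m * φ (t ^ m) else 0

theorem powMul_of_pos (φ : ℝ → ℝ) (m : ℕ) {t : ℝ} (ht : 0 < t) :
    powMul φ m t = t ^ m * φ (t ^ m) := if_pos ht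

theorem powMul_of_nonpos (φ : ℝ → ℝ) (m : ℕ) {t : ℝ} (ht : t ≤ 0) : powMul φ m t = 0 :=
  if_neg ht.not_gt

namespace IsAdmissible

variable {φ : ℝ → ℝ}

theorem hasDerivAt_powMul (hφ : IsAdmissible φ) (m : ℕ) {t : ℝ} (ht : 0 < t) :
    HasDerivAt (powMul φ m) (m * t ^ (m - 1) * deriv (fun σ => σ * φ σ) (t ^ m)) t := by
  have h1 : HasDerivAt (fun σ => σ * φ σ) (deriv (fun σ => σ * φ σ) (t ^ m)) (t ^ m) :=
    (hφ.hasDerivAt_mul (pow_pos ht m)).differentiableAt.hasDerivAt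
  have h2 := h1.comp t (hasDerivAt_pow m t)
  rw [mul_comm] at h2
  refine h2.congr_of_eventuallyEq ?_
  filter_upwards [Ioi_mem_nhds ht] with y hy
  exact powMul_of_pos φ m hy

/-- Near the origin the derivative is at most `m C₂ t^(m(1+r)-1)`, which tends to zero as soon as `m
(1 + r) > 1`. Such an `m` exists because `r > -1`: the power absorbs the singularity of `φ`. -/
theorem exists_contDiff_powMul (hφ : IsAdmissible φ) :
    ∃ m : ℕ, 1 ≤ m ∧ ContDiff ℝ 1 (powMul φ m) := by
  obtain ⟨s₀, hs₀, ⟨C₁, C₂, r, hC₁, hC₂, hr, hb, -⟩, -⟩ := hφ.behaviour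
  have hr' : 0 < 1 + r := by linarith
  obtain ⟨m₀, hm₀⟩ := exists_nat_gt (1 / (1 + r))
  set m := m₀ + 1 with hm
  have hmr : 1 < m * (1 + r) := by
    rw [div_lt_iff₀ hr'] at hm₀
    have : (m : ℝ) = m₀ + 1 := by rw [hm]; push_cast; ring
    rw [this]; nlinarith
  refine ⟨m, by omega, ?_⟩
  have hpow : Tendsto (fun t : ℝ => t ^ m) (𝓝[>] 0) (𝓝[>] 0) := by
    refine tendsto_nhdsWithin_iff.2 ⟨?_, ?_⟩
    · have := (continuous_pow m (M := ℝ)).tendsto 0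
      rw [zero_pow (by omega)] at this
      exact this.mono_left nhdsWithin_le_nhds
    · filter_upwards [self_mem_nhdsWithin] with t ht
      exact pow_pos (mem_Ioi.1 ht) m
  let W' : ℝ → ℝ := fun t => if 0 < t then m * t ^ (m - 1) * deriv (fun σ => σ * φ σ) (t ^ m) else 0
  have hW'pos : ∀ t, 0 < t → W' t = m * t ^ (m - 1) * deriv (fun σ => σ * φ σ) (t ^ m) :=
    fun t ht => if_pos ht
  have hW'neg : ∀ t, t ≤ 0 → W' t = 0 := fun t ht => if_neg ht.not_gt
  have hne : ∀ t ≠ 0, HasDerivAt (powMul φ m) (W' t) t := by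
    intro t ht
    rcases lt_or_gt_of_ne ht with h | h
    · rw [hW'neg t h.le]
      refine (hasDerivAt_const t (0 : ℝ)).congr_of_eventuallyEq ?_
      filter_upwards [Iio_mem_nhds h] with y hy
      exact powMul_of_nonpos φ m (le_of_lt hy)
    · rw [hW'pos t h]
      exact hφ.hasDerivAt_powMul m h
  have hcW : ContinuousAt (powMul φ m) 0 := by
    rw [ContinuousAt, powMul_of_nonpos φ m le_rfl]
    refine (Tendsto.sup ?_ ?_).mono_left (nhdsLE_sup_nhdsGT (0 : ℝ)).ge
    · refine tendsto_const_nhds.congr' ?_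
      filter_upwards [self_mem_nhdsWithin] with t ht
      exact (powMul_of_nonpos φ m ht).symm
    · refine (hφ.tendsto_mul.comp hpow).congr' ?_
      filter_upwards [self_mem_nhdsWithin] with t ht
      exact (powMul_of_pos φ m ht).symm
  have hcW' : ContinuousAt W' 0 := by
    rw [ContinuousAt, hW'neg 0 le_rfl]
    refine (Tendsto.sup ?_ ?_).mono_left (nhdsLE_sup_nhdsGT (0 : ℝ)).ge
    · refine tendsto_const_nhds.congr' ?_
      filter_upwards [self_mem_nhdsWithin] with t ht
      exact (hW'neg t ht).symm
    · have hlim : Tendsto (fun t : ℝ => m * C₂ * t ^ (m * (1 + r) - 1)) (𝓝[>] 0) (𝓝 0) := by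
        have h1 := (Real.continuousAt_rpow_const 0 (m * (1 + r) - 1)
          (Or.inr (by linarith))).tendsto
        rw [Real.zero_rpow (by linarith)] at h1
        have h2 := (h1.mono_left (nhdsWithin_le_nhds (s := Ioi 0))).const_mul (m * C₂)
        rwa [mul_zero] at h2
      refine tendsto_of_tendsto_of_tendsto_of_le_of_le' tendsto_const_nhds hlim ?_ ?_
      · filter_upwards [self_mem_nhdsWithin] with t ht
        have ht' : 0 < t := ht
        rw [hW'pos t ht]
        have := (hφ.deriv_pos _ (pow_pos ht' m)).le
        positivity
      · filter_upwards [self_mem_nhdsWithin, hpow (Ioo_mem_nhdsGT hs₀)] with t ht hts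
        have ht' : 0 < t := ht
        rw [hW'pos t ht]
        have h1 := (hb _ hts).2
        have e : m * C₂ * t ^ (m * (1 + r) - 1) = m * t ^ (m - 1) * (C₂ * (t ^ m) ^ r) := by
          rw [← Real.rpow_natCast t (m - 1), ← Real.rpow_natCast t m, ← Real.rpow_mul ht'.le]
          have : (m * (1 + r) - 1 : ℝ) = ((m - 1 : ℕ) : ℝ) + m * r := by
            rw [hm]; push_cast [Nat.add_sub_cancel]; ring
          rw [this, Real.rpow_add ht']; ring
        rw [e]
        gcongr
  have hall : ∀ t, HasDerivAt (powMul φ m) (W' t) t := by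
    intro t
    by_cases ht : t = 0
    · subst ht
      exact hasDerivAt_of_hasDerivAt_of_ne (fun y hy => hne y hy) hcW hcW'
    · exact hne t ht
  rw [contDiff_one_iff_deriv]
  refine ⟨fun t => (hall t).differentiableAt, ?_⟩
  rw [show deriv (powMul φ m) = W' from funext fun t => (hall t).deriv, continuous_iff_continuousAt]
  intro t
  rcases lt_trichotomy t 0 with h | h | h
  · have h0 : ContinuousAt (fun _ : ℝ => (0 : ℝ)) t := continuousAt_const
    refine h0.congr ?_
    filter_upwards [Iio_mem_nhds h] with y hy
    exact (hW'neg y (le_of_lt hy)).symm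
  · rw [h]; exact hcW'
  · have h1 : ContinuousAt (fun t : ℝ => m * t ^ (m - 1) * deriv (fun σ => σ * φ σ) (t ^ m)) t := by
      refine ContinuousAt.mul (by fun_prop) ?_
      exact ContinuousAt.comp (f := fun t : ℝ => t ^ m)
        (hφ.continuousOn_deriv_mul.continuousAt (Ioi_mem_nhds (pow_pos h m))) (by fun_prop)
    refine h1.congr ?_
    filter_upwards [Ioi_mem_nhds h] with y hy
    exact (hW'pos y hy).symm

end IsAdmissible

/-- The function `G(ρ) exp(iθ)`. -/
noncomputable def polarFun {E : Type*} (G : ℝ → ℝ) (ρ θ : E → ℝ) (x : E) : ℂ :=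
  (G (ρ x) : ℂ) * Complex.exp (θ x * Complex.I)

theorem contDiff_polarFun {E : Type*} [NormedAddCommGroup E] [NormedSpace ℝ E] {G : ℝ → ℝ}
    {ρ θ : E → ℝ} (hG : ContDiff ℝ 1 G) (hρ : ContDiff ℝ 1 ρ) (hθ : ContDiff ℝ 1 θ) :
    ContDiff ℝ 1 (polarFun G ρ θ) :=
  (Complex.ofRealCLM.contDiff.comp (hG.comp hρ)).mul
    ((Complex.ofRealCLM.contDiff.comp hθ).mul contDiff_const).cexp

theorem support_polarFun_subset {E : Type*} {G : ℝ → ℝ} (hG : G 0 = 0) (ρ θ : E → ℝ) :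
    Function.support (polarFun G ρ θ) ⊆ Function.support ρ := by
  intro x hx h
  apply hx
  simp [polarFun, h, hG]

theorem fderiv_polarFun {E : Type*} [NormedAddCommGroup E] [NormedSpace ℝ E] {G : ℝ → ℝ}
    {ρ θ : E → ℝ} (hG : ContDiff ℝ 1 G) (hρ : ContDiff ℝ 1 ρ) (hθ : ContDiff ℝ 1 θ) (x v : E) :
    fderiv ℝ (polarFun G ρ θ) x v = Complex.exp (θ x * Complex.I) *
      ((deriv G (ρ x) : ℝ) * fderiv ℝ ρ x v + (G (ρ x) : ℝ) * fderiv ℝ θ x v * Complex.I) := by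
  have h1 : HasFDerivAt (fun y => G (ρ y)) (deriv G (ρ x) • fderiv ℝ ρ x) x :=
    (hG.differentiable one_ne_zero _).hasDerivAt.comp_hasFDerivAt x
      (hρ.differentiable one_ne_zero x).hasFDerivAt
  have h2 : HasFDerivAt (fun y => (G (ρ y) : ℂ))
      (Complex.ofRealCLM.comp (deriv G (ρ x) • fderiv ℝ ρ x)) x :=
    Complex.ofRealCLM.hasFDerivAt.comp x h1
  have h3 : HasFDerivAt (fun y => (θ y : ℂ)) (Complex.ofRealCLM.comp (fderiv ℝ θ x)) x :=
    Complex.ofRealCLM.hasFDerivAt.comp x (hθ.differentiable one_ne_zero x).hasFDerivAt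
  have h4 := (h3.mul_const Complex.I).cexp
  have h5 := (h2.mul h4).fderiv
  change fderiv ℝ (polarFun G ρ θ) x = _ at h5
  rw [h5]
  simp
  ring

/-- `u` and `φ(|u|) u` share the phase `θ` and differ only in their amplitudes, both of them
functions of `ρ` that are `C¹` for suitable `m`. -/
theorem phiMul_polarFun_pow {N : ℕ} (φ : ℝ → ℝ) {m : ℕ} (hm : 1 ≤ m)
    {ρ : EuclideanSpace ℝ (Fin N) → ℝ} (hρ : ∀ x, 0 ≤ ρ x) (θ : EuclideanSpace ℝ (Fin N) → ℝ) :
    phiMul φ (polarFun (fun t => t ^ m) ρ θ) = polarFun (powMul φ m) ρ θ := by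
  ext x
  rcases (hρ x).eq_or_lt with h | h
  · have : (0 : ℝ) ^ m = 0 := zero_pow (by omega)
    simp [phiMul, polarFun, ← h, powMul, this]
  · have : ‖polarFun (fun t => t ^ m) ρ θ x‖ = ρ x ^ m := by
      rw [polarFun, norm_mul, Complex.norm_exp_ofReal_mul_I, mul_one, Complex.norm_real,
        Real.norm_of_nonneg (by positivity)]
    rw [phiMul, this, polarFun, polarFun, powMul_of_pos φ m h]
    push_cast
    ring

/-- `∫_Ω k₁(ρ) ⟨Re A ∇ρ, ∇ρ⟩ + k₂(ρ) ⟨Re A ∇θ, ∇θ⟩ + k₃(ρ) ⟨Im A ∇ρ, ∇θ⟩`. -/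
noncomputable def polarForm {N : ℕ} (Ω : TopologicalSpace.Opens (EuclideanSpace ℝ (Fin N)))
    (A : EuclideanSpace ℝ (Fin N) → Matrix (Fin N) (Fin N) ℂ) (k₁ k₂ k₃ : ℝ → ℝ)
    (ρ θ : EuclideanSpace ℝ (Fin N) → ℝ) : ℝ :=
  ∑ i, ∑ j,
    ((∫ x in (Ω : Set (EuclideanSpace ℝ (Fin N))), (A x i j).re *
        (k₁ (ρ x) * (fderiv ℝ ρ x (EuclideanSpace.single j 1) *
            fderiv ℝ ρ x (EuclideanSpace.single i 1)) +
          k₂ (ρ x) * (fderiv ℝ θ x (EuclideanSpace.single j 1) *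
            fderiv ℝ θ x (EuclideanSpace.single i 1)))) +
      ∫ x in (Ω : Set (EuclideanSpace ℝ (Fin N))), (A x i j).im *
        (k₃ (ρ x) * (fderiv ℝ ρ x (EuclideanSpace.single j 1) *
          fderiv ℝ θ x (EuclideanSpace.single i 1))))

/-- Allows limits to be taken coefficient by coefficient and the quadratic form to be reassembled
afterwards. -/
theorem sum_sum_integral_add {α ι : Type*} [Fintype ι] [MeasurableSpace α] {μ : Measure α}
    {f g : ι → ι → α → ℝ} (hf : ∀ i j, Integrable (f i j) μ) (hg : ∀ i j, Integrable (g i j) μ) :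
    ∑ i, ∑ j, (∫ x, f i j x ∂μ + ∫ x, g i j x ∂μ) = ∫ x, ∑ i, ∑ j, (f i j x + g i j x) ∂μ := by
  have h : ∀ i j, Integrable (fun x => f i j x + g i j x) μ := fun i j => (hf i j).add (hg i j)
  rw [integral_finsetSum _ fun i _ => integrable_finsetSum _ fun j _ => h i j]
  refine Finset.sum_congr rfl fun i _ => ?_
  rw [integral_finsetSum _ fun j _ => h i j]
  exact Finset.sum_congr rfl fun j _ => (integral_add (hf i j) (hg i j)).symm

theorem integrable_mul_of_continuous {N : ℕ}
    {Ω : TopologicalSpace.Opens (EuclideanSpace ℝ (Fin N))} {𝕜 : Type*} [NormedRing 𝕜]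
    {b f : EuclideanSpace ℝ (Fin N) → 𝕜} (hb : MemLp b ∞ (volume.restrict Ω)) (hf : Continuous f)
    (hc : HasCompactSupport f) : Integrable (fun x => b x * f x) (volume.restrict Ω) :=
  hb.integrable_mul ((hf.memLp_of_hasCompactSupport (p := 1) hc).restrict _)

/-- Dissipativity tested on `ρ^m exp(iθ)`; the phase has modulus one and drops out. No support
condition on `θ` is needed, because both amplitudes vanish where `ρ` does. -/
theorem IsFunctionalDissipative.polarForm_nonneg {N : ℕ}
    {Ω : TopologicalSpace.Opens (EuclideanSpace ℝ (Fin N))}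
    {A : EuclideanSpace ℝ (Fin N) → Matrix (Fin N) (Fin N) ℂ}
    (hA : ∀ i j, MemLp (fun x => A x i j) ∞ (volume.restrict Ω))
    (hsymm : ∀ᵐ x ∂volume.restrict (Ω : Set (EuclideanSpace ℝ (Fin N))),
      ((A x).map Complex.im)ᵀ = (A x).map Complex.im)
    {φ : ℝ → ℝ} (hd : IsFunctionalDissipative Ω A φ) {m : ℕ} (hm : 1 ≤ m)
    (hW : ContDiff ℝ 1 (powMul φ m)) {ρ θ : EuclideanSpace ℝ (Fin N) → ℝ} (hρ : ContDiff ℝ 1 ρ)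
    (hθ : ContDiff ℝ 1 θ) (hρ0 : ∀ x, 0 ≤ ρ x) (hρc : HasCompactSupport ρ) (hρs : tsupport ρ ⊆ Ω) :
    0 ≤ polarForm Ω A (fun t => m * t ^ (m - 1) * deriv (powMul φ m) t)
      (fun t => t ^ m * powMul φ m t)
      (fun t => m * t ^ (m - 1) * powMul φ m t - deriv (powMul φ m) t * t ^ m) ρ θ := by
  have hG : ContDiff ℝ 1 (fun t : ℝ => t ^ m) := contDiff_id.pow m
  have hG0 : (0 : ℝ) ^ m = 0 := zero_pow (by omega)
  have hW0 : powMul φ m 0 = 0 := powMul_of_nonpos φ m le_rfl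
  set u := polarFun (fun t => t ^ m) ρ θ with hu
  set v := polarFun (powMul φ m) ρ θ with hv
  have huC : ContDiff ℝ 1 u := contDiff_polarFun hG hρ hθ
  have hvC : ContDiff ℝ 1 v := contDiff_polarFun hW hρ hθ
  have hus : tsupport u ⊆ tsupport ρ := closure_mono (support_polarFun_subset hG0 ρ θ)
  have hvs : tsupport v ⊆ tsupport ρ := closure_mono (support_polarFun_subset hW0 ρ θ)
  have huc : HasCompactSupport u := hρc.isCompact.of_isClosed_subset (isClosed_tsupport _) hus
  have hvc : HasCompactSupport v := hρc.isCompact.of_isClosed_subset (isClosed_tsupport _) hvs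
  have huv : phiMul φ u = v := phiMul_polarFun_pow φ hm hρ0 θ
  have hmain := hd u (memH10_of_contDiff huC huc (hus.trans hρs))
    (by rw [huv]; exact memH10_of_contDiff hvC hvc (hvs.trans hρs)) (classicalGradient u)
    (classicalGradient v) (hasWeakGradient_of_contDiff Ω huC)
    (by rw [huv]; exact hasWeakGradient_of_contDiff Ω hvC)
  have hcu := continuous_classicalGradient huC
  have hcv := continuous_classicalGradient hvC
  have hint : Integrable (fun x => (A x *ᵥ (classicalGradient u x).ofLp) ⬝ᵥ
      star (classicalGradient v x).ofLp) (volume.restrict Ω) := by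
    simp only [dotProduct, Matrix.mulVec, Finset.sum_mul]
    refine integrable_finsetSum _ fun i _ => integrable_finsetSum _ fun j _ => ?_
    simp only [mul_assoc]
    refine integrable_mul_of_continuous (hA i j) ?_ ?_
    · exact ((PiLp.continuous_apply 2 _ j).comp hcu).mul
        (continuous_star.comp ((PiLp.continuous_apply 2 _ i).comp hcv))
    · exact HasCompactSupport.mul_right (huc.fderiv_apply (𝕜 := ℝ) _)
  have hre : (gradForm Ω A (classicalGradient u) (classicalGradient v)).re =
      ∫ x in (Ω : Set (EuclideanSpace ℝ (Fin N))),
      ((A x *ᵥ (classicalGradient u x).ofLp) ⬝ᵥ star (classicalGradient v x).ofLp).re :=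
    (integral_re (𝕜 := ℂ) hint).symm
  rw [hre] at hmain
  refine hmain.trans_eq ?_
  have hρd : ∀ i : Fin N, Continuous fun x => fderiv ℝ ρ x (EuclideanSpace.single i 1) :=
    fun i => (hρ.continuous_fderiv one_ne_zero).clm_apply continuous_const
  have hθd : ∀ i : Fin N, Continuous fun x => fderiv ℝ θ x (EuclideanSpace.single i 1) :=
    fun i => (hθ.continuous_fderiv one_ne_zero).clm_apply continuous_const
  have hW'c : Continuous (deriv (powMul φ m)) := hW.continuous_deriv le_rfl
  have hWc := hW.continuous
  have hρC := hρ.continuous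
  have hρdc : ∀ i : Fin N, HasCompactSupport fun x => fderiv ℝ ρ x (EuclideanSpace.single i 1) :=
    fun i => hρc.fderiv_apply (𝕜 := ℝ) _
  have hint1 : ∀ i j, Integrable (fun x => (A x i j).re *
        ((m * ρ x ^ (m - 1) * deriv (powMul φ m) (ρ x)) *
          (fderiv ℝ ρ x (EuclideanSpace.single j 1) *
            fderiv ℝ ρ x (EuclideanSpace.single i 1)) +
          (ρ x ^ m * powMul φ m (ρ x)) * (fderiv ℝ θ x (EuclideanSpace.single j 1) *
            fderiv ℝ θ x (EuclideanSpace.single i 1)))) (volume.restrict Ω) := by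
    intro i j
    refine integrable_mul_of_continuous (hA i j).re ?_ ?_
    · have h1 := hρd i
      have h2 := hρd j
      have h3 := hθd i
      have h4 := hθd j
      fun_prop
    · refine HasCompactSupport.add (HasCompactSupport.mul_left (hρdc j).mul_right)
        (HasCompactSupport.mul_right (HasCompactSupport.mul_left ?_))
      exact hρc.comp_left (g := powMul φ m) hW0
  have hint2 : ∀ i j, Integrable (fun x => (A x i j).im *
        ((m * ρ x ^ (m - 1) * powMul φ m (ρ x) - deriv (powMul φ m) (ρ x) * ρ x ^ m) *
          (fderiv ℝ ρ x (EuclideanSpace.single j 1) *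
            fderiv ℝ θ x (EuclideanSpace.single i 1)))) (volume.restrict Ω) := by
    intro i j
    refine integrable_mul_of_continuous (hA i j).im ?_ ?_
    · have h2 := hρd j
      have h3 := hθd i
      fun_prop
    · exact HasCompactSupport.mul_left (hρdc j).mul_right
  refine Eq.trans ?_ (sum_sum_integral_add hint1 hint2).symm
  refine integral_congr_ae ?_
  filter_upwards [hsymm] with x hx
  have hgu : (classicalGradient u x).ofLp = fun j => Complex.exp (θ x * Complex.I) *
      (((m * ρ x ^ (m - 1) : ℝ) : ℂ) * fderiv ℝ ρ x (EuclideanSpace.single j 1) +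
        ((ρ x ^ m : ℝ) : ℂ) * fderiv ℝ θ x (EuclideanSpace.single j 1) * Complex.I) := by
    funext j
    rw [classicalGradient_apply, hu, fderiv_polarFun hG hρ hθ]
    simp
  have hgv : (classicalGradient v x).ofLp = fun j => Complex.exp (θ x * Complex.I) *
      (((deriv (powMul φ m) (ρ x) : ℝ) : ℂ) * fderiv ℝ ρ x (EuclideanSpace.single j 1) +
        ((powMul φ m (ρ x) : ℝ) : ℂ) * fderiv ℝ θ x (EuclideanSpace.single j 1) * Complex.I) := by
    funext j
    rw [classicalGradient_apply, hv, fderiv_polarFun hW hρ hθ]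
  rw [hgu, hgv, re_mulVec_dotProduct_star _ hx, Complex.norm_exp_ofReal_mul_I]
  simp only [dotProduct, Matrix.mulVec, Matrix.map_apply, Finset.sum_mul, Finset.mul_sum,
    ← Finset.sum_add_distrib]
  refine Finset.sum_congr rfl fun i _ => Finset.sum_congr rfl fun j _ => ?_
  ring

/-! ### Small oscillations of high frequency. -/

section Oscillation

variable {E : Type*} [NormedAddCommGroup E] [NormedSpace ℝ E]

/-- A cut-off `α η` plus a small oscillation of high frequency. -/
noncomputable def ripple (η ζ : E → ℝ) (ℓ : E →L[ℝ] ℝ) (δ α a ν : ℝ) (x : E) : ℝ :=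
  α * η x + a / ν * (ζ x * Real.sin (ν ^ 2 * ℓ x + δ))

/-- The derivative of `ripple`, divided by `ν`. -/
noncomputable def rippleDeriv (η ζ : E → ℝ) (ℓ : E →L[ℝ] ℝ) (δ α a ν : ℝ) (v x : E) : ℝ :=
  α * fderiv ℝ η x v / ν + a * (ζ x * Real.cos (ν ^ 2 * ℓ x + δ) * ℓ v +
    Real.sin (ν ^ 2 * ℓ x + δ) * fderiv ℝ ζ x v / ν ^ 2)

variable {η ζ : E → ℝ} (ℓ : E →L[ℝ] ℝ)

theorem contDiff_ripple (hη : ContDiff ℝ 1 η) (hζ : ContDiff ℝ 1 ζ) (δ α a ν : ℝ) :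
    ContDiff ℝ 1 (ripple η ζ ℓ δ α a ν) :=
  (contDiff_const.mul hη).add (contDiff_const.mul
    (hζ.mul (((contDiff_const.mul ℓ.contDiff).add contDiff_const).sin)))

/-- Amplitude `a / ν` against frequency `ν²` makes the derivative of order `ν` while the values
converge. After division by `ν` only the oscillating term survives in the limit. -/
theorem fderiv_ripple (hη : ContDiff ℝ 1 η) (hζ : ContDiff ℝ 1 ζ) (δ α a : ℝ) {ν : ℝ}
    (hν : ν ≠ 0) (x v : E) : fderiv ℝ (ripple η ζ ℓ δ α a ν) x v =
      ν * rippleDeriv η ζ ℓ δ α a ν v x := by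
  have h1 := ((hη.differentiable one_ne_zero x).hasFDerivAt).const_mul α
  have h2 : HasFDerivAt (fun y => ν ^ 2 * ℓ y + δ) (ν ^ 2 • ℓ) x :=
    (ℓ.hasFDerivAt.const_mul (ν ^ 2)).add_const δ
  have h3 := (((hζ.differentiable one_ne_zero x).hasFDerivAt).mul h2.sin).const_mul (a / ν)
  have h4 := (h1.add h3).fderiv
  change fderiv ℝ (ripple η ζ ℓ δ α a ν) x = _ at h4
  rw [h4]
  simp [rippleDeriv]
  field_simp

theorem continuous_rippleDeriv (hη : ContDiff ℝ 1 η) (hζ : ContDiff ℝ 1 ζ) (δ α a ν : ℝ)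
    (v : E) : Continuous (rippleDeriv η ζ ℓ δ α a ν v) := by
  have h1 : Continuous fun x => fderiv ℝ η x v :=
    (hη.continuous_fderiv one_ne_zero).clm_apply continuous_const
  have h2 : Continuous fun x => fderiv ℝ ζ x v :=
    (hζ.continuous_fderiv one_ne_zero).clm_apply continuous_const
  have h3 := hζ.continuous
  unfold rippleDeriv
  fun_prop

theorem rippleDeriv_eq_zero (hηζ : tsupport ζ ⊆ tsupport η) (δ α a ν : ℝ) (v : E) {x : E}
    (hx : x ∉ tsupport η) : rippleDeriv η ζ ℓ δ α a ν v x = 0 := by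
  have hx' : x ∉ tsupport ζ := fun h => hx (hηζ h)
  have h1 : fderiv ℝ η x = 0 := by
    by_contra h
    exact hx (support_fderiv_subset ℝ h)
  have h2 : fderiv ℝ ζ x = 0 := by
    by_contra h
    exact hx' (support_fderiv_subset ℝ h)
  simp [rippleDeriv, h1, h2, image_eq_zero_of_notMem_tsupport hx']

theorem abs_rippleDeriv_le (hζ0 : ∀ x, 0 ≤ ζ x) (hζ1 : ∀ x, ζ x ≤ 1) {Mη Mζ : ℝ}
    (hMη : ∀ x, ‖fderiv ℝ η x‖ ≤ Mη) (hMζ : ∀ x, ‖fderiv ℝ ζ x‖ ≤ Mζ) (δ α a : ℝ) {ν : ℝ}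
    (hν : 1 ≤ ν) (v x : E) :
    |rippleDeriv η ζ ℓ δ α a ν v x| ≤
      |α| * (Mη * ‖v‖) + |a| * (‖ℓ‖ * ‖v‖ + Mζ * ‖v‖) := by
  have hν0 : 0 < ν := one_pos.trans_le hν
  have h1 : |fderiv ℝ η x v| ≤ Mη * ‖v‖ := (fderiv ℝ η x).le_of_opNorm_le (hMη x) v
  have h2 : |fderiv ℝ ζ x v| ≤ Mζ * ‖v‖ := (fderiv ℝ ζ x).le_of_opNorm_le (hMζ x) v
  have h3 : |ℓ v| ≤ ‖ℓ‖ * ‖v‖ := ℓ.le_opNorm v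
  have h4 : ∀ y, |ζ x * Real.cos y * ℓ v| ≤ ‖ℓ‖ * ‖v‖ := fun y => by
    rw [abs_mul, abs_mul, abs_of_nonneg (hζ0 x)]
    have : ζ x * |Real.cos y| ≤ 1 := mul_le_one₀ (hζ1 x) (abs_nonneg _) (Real.abs_cos_le_one _)
    calc ζ x * |Real.cos y| * |ℓ v| ≤ 1 * |ℓ v| := by gcongr
      _ ≤ _ := by rw [one_mul]; exact h3
  have h5 : ∀ y, |Real.sin y * fderiv ℝ ζ x v / ν ^ 2| ≤ Mζ * ‖v‖ := fun y => by
    rw [abs_div, abs_mul, abs_of_pos (by positivity : 0 < ν ^ 2)]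
    refine (div_le_self (by positivity) (one_le_pow₀ hν)).trans ?_
    calc |Real.sin y| * |fderiv ℝ ζ x v| ≤ 1 * |fderiv ℝ ζ x v| := by
          gcongr; exact Real.abs_sin_le_one _
      _ ≤ _ := by rw [one_mul]; exact h2
  have h6 : |α * fderiv ℝ η x v / ν| ≤ |α| * (Mη * ‖v‖) := by
    rw [abs_div, abs_mul, abs_of_pos hν0]
    refine (div_le_self (by positivity) hν).trans ?_
    gcongr
  refine (abs_add_le _ _).trans (add_le_add h6 ?_)
  rw [abs_mul]
  gcongr
  exact (abs_add_le _ _).trans (add_le_add (h4 _) (h5 _))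

/-- Here `c` will be the cosine factor, which is bounded but need not converge; hence the statement
through differences. -/
theorem tendsto_mul_mul_sub {k p q c : ℕ → ℝ} {k₀ X Y : ℝ} (hk : Tendsto k atTop (𝓝 k₀))
    (hc : ∀ n, |c n| ≤ 1) (hp : Tendsto (fun n => p n - c n * X) atTop (𝓝 0))
    (hq : Tendsto (fun n => q n - c n * Y) atTop (𝓝 0)) :
    Tendsto (fun n => k n * (p n * q n) - c n ^ 2 * (k₀ * (X * Y))) atTop (𝓝 0) := by
  have hcb : ∀ {r : ℕ → ℝ}, Tendsto r atTop (𝓝 0) → Tendsto (fun n => c n * r n) atTop (𝓝 0) := by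
    intro r hr
    have hr' := hr.norm
    rw [norm_zero] at hr'
    refine squeeze_zero_norm (fun n => ?_) hr'
    rw [norm_mul]
    exact mul_le_of_le_one_left (norm_nonneg _) (hc n)
  have hk' : Tendsto (fun n => k n - k₀) atTop (𝓝 0) := by
    simpa using hk.sub_const k₀
  have h := ((hk.mul (((hp.mul hq).add ((hcb hp).const_mul Y)).add ((hcb hq).const_mul X))).add
    ((hcb (hcb hk')).const_mul (X * Y)))
  simp only [mul_zero, add_zero] at h
  refine h.congr fun n => ?_
  ring

theorem tendsto_rippleDeriv_sub (η ζ : E → ℝ) (δ α a : ℝ) (v x : E) :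
    Tendsto (fun n : ℕ => rippleDeriv η ζ ℓ δ α a (n + 1) v x -
      Real.cos ((n + 1 : ℝ) ^ 2 * ℓ x + δ) * (a * (ζ x * ℓ v))) atTop (𝓝 0) := by
  have hlim : Tendsto (fun n : ℕ => (|α * fderiv ℝ η x v| + |a * fderiv ℝ ζ x v|) *
      (1 / ((n : ℝ) + 1))) atTop (𝓝 0) := by
    have := (tendsto_one_div_add_atTop_nhds_zero_nat (𝕜 := ℝ)).const_mul
      (|α * fderiv ℝ η x v| + |a * fderiv ℝ ζ x v|)
    rwa [mul_zero] at this
  refine squeeze_zero_norm (fun n => ?_) hlim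
  have hν : (1 : ℝ) ≤ n + 1 := by linarith [n.cast_nonneg (α := ℝ)]
  have hν0 : (0 : ℝ) < n + 1 := by linarith
  have e : rippleDeriv η ζ ℓ δ α a (n + 1) v x -
      Real.cos ((n + 1 : ℝ) ^ 2 * ℓ x + δ) * (a * (ζ x * ℓ v)) =
      α * fderiv ℝ η x v / (n + 1) + Real.sin ((n + 1 : ℝ) ^ 2 * ℓ x + δ) *
        (a * fderiv ℝ ζ x v) / (n + 1) ^ 2 := by
    rw [rippleDeriv]; ring
  rw [e, add_mul]
  refine (norm_add_le _ _).trans (add_le_add ?_ ?_)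
  · rw [Real.norm_eq_abs, abs_div, abs_of_pos hν0, mul_one_div]
  · rw [Real.norm_eq_abs, abs_div, abs_mul, abs_of_pos (by positivity : (0 : ℝ) < (n + 1) ^ 2),
      mul_one_div]
    gcongr
    · exact mul_le_of_le_one_left (abs_nonneg _) (Real.abs_sin_le_one _)
    · exact le_self_pow₀ hν two_ne_zero

theorem tendsto_ripple (η ζ : E → ℝ) (δ α a : ℝ) (x : E) :
    Tendsto (fun n : ℕ => ripple η ζ ℓ δ α a (n + 1) x) atTop (𝓝 (α * η x)) := by
  have hlim : Tendsto (fun n : ℕ => |a * ζ x| * (1 / ((n : ℝ) + 1))) atTop (𝓝 0) := by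
    have := (tendsto_one_div_add_atTop_nhds_zero_nat (𝕜 := ℝ)).const_mul |a * ζ x|
    rwa [mul_zero] at this
  rw [tendsto_iff_norm_sub_tendsto_zero]
  refine squeeze_zero_norm (fun n => ?_) hlim
  have hν0 : (0 : ℝ) < n + 1 := by positivity
  have e : ripple η ζ ℓ δ α a (n + 1) x - α * η x =
      Real.sin ((n + 1 : ℝ) ^ 2 * ℓ x + δ) * (a * ζ x) * (1 / (n + 1)) := by
    rw [ripple]; ring
  rw [norm_norm, e, norm_mul, Real.norm_of_nonneg (by positivity : (0 : ℝ) ≤ 1 / (n + 1))]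
  gcongr
  rw [Real.norm_eq_abs, abs_mul]
  exact mul_le_of_le_one_left (abs_nonneg _) (Real.abs_sin_le_one _)

end Oscillation

/-! ### Cut-off pairs and the limit of the polar form. -/

/-- Conditions on a pair of cut-off functions, `η` being one on the support of `ζ`. -/
structure IsCutoffPair {E : Type*} [NormedAddCommGroup E] [NormedSpace ℝ E] (η ζ : E → ℝ) :
    Prop where
  contDiff : ContDiff ℝ 1 η
  contDiff' : ContDiff ℝ 1 ζ
  hasCompactSupport : HasCompactSupport η
  nonneg : ∀ x, 0 ≤ η x
  nonneg' : ∀ x, 0 ≤ ζ x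
  le_one' : ∀ x, ζ x ≤ 1
  eq_one : ∀ x, ζ x ≠ 0 → η x = 1

namespace IsCutoffPair

theorem tsupport_subset {E : Type*} [NormedAddCommGroup E] [NormedSpace ℝ E] {η ζ : E → ℝ}
    (h : IsCutoffPair η ζ) : tsupport ζ ⊆ tsupport η :=
  closure_mono fun x hx => by simp [h.eq_one x hx]

theorem hasCompactSupport' {E : Type*} [NormedAddCommGroup E] [NormedSpace ℝ E] {η ζ : E → ℝ}
    (h : IsCutoffPair η ζ) : HasCompactSupport ζ :=
  h.hasCompactSupport.isCompact.of_isClosed_subset (isClosed_tsupport _) h.tsupport_subset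

theorem integrable_ripple {N : ℕ} {Ω : TopologicalSpace.Opens (EuclideanSpace ℝ (Fin N))}
    {η ζ : EuclideanSpace ℝ (Fin N) → ℝ} (h : IsCutoffPair η ζ)
    {B : EuclideanSpace ℝ (Fin N) → ℝ} (hB : MemLp B ∞ (volume.restrict Ω))
    (ℓ : EuclideanSpace ℝ (Fin N) →L[ℝ] ℝ) {k : ℝ → ℝ} (hk : Continuous k)
    (δ τ a₀ α a α' a' ν : ℝ) (v w : EuclideanSpace ℝ (Fin N)) :
    Integrable (fun x => B x * (k (ripple η ζ ℓ δ τ a₀ ν x) *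
      (rippleDeriv η ζ ℓ δ α a ν v x * rippleDeriv η ζ ℓ δ α' a' ν w x)))
      (volume.restrict Ω) := by
  refine integrable_mul_of_continuous hB ?_ ?_
  · exact (hk.comp (contDiff_ripple ℓ h.contDiff h.contDiff' _ _ _ _).continuous).mul
      ((continuous_rippleDeriv ℓ h.contDiff h.contDiff' _ _ _ _ _).mul
        (continuous_rippleDeriv ℓ h.contDiff h.contDiff' _ _ _ _ _))
  · refine h.hasCompactSupport.mono' fun x hx => ?_
    by_contra hx'
    apply hx
    simp [rippleDeriv_eq_zero ℓ h.tsupport_subset _ _ _ _ _ hx']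

/-- Adding the phases `0` and `π/2` turns the oscillating factors into `cos² + sin² = 1`. The sum
therefore converges pointwise, and dominated convergence replaces an argument by weak convergence.
-/
theorem tendsto_integral_ripple {N : ℕ}
    {Ω : TopologicalSpace.Opens (EuclideanSpace ℝ (Fin N))}
    {η ζ : EuclideanSpace ℝ (Fin N) → ℝ} (h : IsCutoffPair η ζ)
    {B : EuclideanSpace ℝ (Fin N) → ℝ} (hB : MemLp B ∞ (volume.restrict Ω))
    (ℓ : EuclideanSpace ℝ (Fin N) →L[ℝ] ℝ) {k : ℝ → ℝ} (hk : Continuous k)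
    (τ a₀ α a α' a' : ℝ) (v w : EuclideanSpace ℝ (Fin N)) :
    Tendsto (fun n : ℕ =>
      (∫ x in (Ω : Set (EuclideanSpace ℝ (Fin N))),
        B x * (k (ripple η ζ ℓ 0 τ a₀ (n + 1) x) *
        (rippleDeriv η ζ ℓ 0 α a (n + 1) v x * rippleDeriv η ζ ℓ 0 α' a' (n + 1) w x))) +
      ∫ x in (Ω : Set (EuclideanSpace ℝ (Fin N))),
        B x * (k (ripple η ζ ℓ (Real.pi / 2) τ a₀ (n + 1) x) *
        (rippleDeriv η ζ ℓ (Real.pi / 2) α a (n + 1) v x *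
          rippleDeriv η ζ ℓ (Real.pi / 2) α' a' (n + 1) w x))) atTop
      (𝓝 (∫ x in (Ω : Set (EuclideanSpace ℝ (Fin N))),
        B x * (ζ x ^ 2 * (k τ * (a * a') * (ℓ v * ℓ w))))) := by
  obtain ⟨M, hM⟩ := h.contDiff.continuous.bounded_above_of_compact_support h.hasCompactSupport
  obtain ⟨Mη, hMη⟩ := (h.contDiff.continuous_fderiv one_ne_zero).bounded_above_of_compact_support
    (h.hasCompactSupport.fderiv (𝕜 := ℝ))
  obtain ⟨Mζ, hMζ⟩ := (h.contDiff'.continuous_fderiv one_ne_zero).bounded_above_of_compact_support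
    (h.hasCompactSupport'.fderiv (𝕜 := ℝ))
  have hMη0 : 0 ≤ Mη := (norm_nonneg _).trans (hMη 0)
  have hMζ0 : 0 ≤ Mζ := (norm_nonneg _).trans (hMζ 0)
  -- All ripples take values in `[-T, T]` because `ν ≥ 1`, and `k` is bounded there.
  set T := |τ| * M + |a₀| with hT
  obtain ⟨D, hD⟩ := (isCompact_Icc (a := -T) (b := T)).exists_bound_of_continuousOn hk.continuousOn
  set V := |α| * (Mη * ‖v‖) + |a| * (‖ℓ‖ * ‖v‖ + Mζ * ‖v‖) with hV
  set V' := |α'| * (Mη * ‖w‖) + |a'| * (‖ℓ‖ * ‖w‖ + Mζ * ‖w‖) with hV'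
  have hVn : 0 ≤ V := by positivity
  have hbound : ∀ (δ : ℝ) (n : ℕ) x, ‖k (ripple η ζ ℓ δ τ a₀ (n + 1) x) *
        (rippleDeriv η ζ ℓ δ α a (n + 1) v x * rippleDeriv η ζ ℓ δ α' a' (n + 1) w x)‖ ≤
        (tsupport η).indicator (fun _ => D * (V * V')) x := by
    intro δ n x
    have hν : (1 : ℝ) ≤ n + 1 := by linarith [n.cast_nonneg (α := ℝ)]
    by_cases hx : x ∈ tsupport η
    · rw [indicator_of_mem hx, norm_mul, norm_mul]
      have hosc : |ripple η ζ ℓ δ τ a₀ (n + 1) x| ≤ T := by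
        refine (abs_add_le _ _).trans (add_le_add ?_ ?_)
        · rw [abs_mul]
          gcongr
          exact hM x
        · rw [abs_mul, abs_div, abs_mul, abs_of_nonneg (h.nonneg' x),
            abs_of_nonneg (by linarith : (0 : ℝ) ≤ n + 1)]
          have h1 : ζ x * |Real.sin ((n + 1 : ℝ) ^ 2 * ℓ x + δ)| ≤ 1 :=
            mul_le_one₀ (h.le_one' x) (abs_nonneg _) (Real.abs_sin_le_one _)
          have h2 : |a₀| / (n + 1 : ℝ) ≤ |a₀| := div_le_self (abs_nonneg _) hν
          exact (mul_le_of_le_one_right (by positivity) h1).trans h2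
      have hD' := hD _ (mem_Icc.2 (abs_le.1 hosc))
      have h1 := abs_rippleDeriv_le ℓ h.nonneg' h.le_one' hMη hMζ δ α a hν v x
      have h2 := abs_rippleDeriv_le ℓ h.nonneg' h.le_one' hMη hMζ δ α' a' hν w x
      have hD0 : 0 ≤ D := (norm_nonneg _).trans hD'
      exact mul_le_mul hD' (mul_le_mul h1 h2 (norm_nonneg _) hVn) (by positivity) hD0
    · rw [indicator_of_notMem hx]
      simp [rippleDeriv_eq_zero ℓ h.tsupport_subset _ _ _ _ _ hx]
  have hK : IsCompact (tsupport η) := h.hasCompactSupport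
  have hind : MemLp ((tsupport η).indicator fun _ => D * (V * V')) 1 (volume.restrict Ω) := by
    refine MemLp.restrict _ (memLp_indicator_const 1 hK.measurableSet _ (Or.inr ?_))
    exact hK.measure_lt_top.ne
  have hptw : ∀ (δ : ℝ) x, Tendsto (fun n : ℕ => k (ripple η ζ ℓ δ τ a₀ (n + 1) x) *
        (rippleDeriv η ζ ℓ δ α a (n + 1) v x * rippleDeriv η ζ ℓ δ α' a' (n + 1) w x) -
        Real.cos ((n + 1 : ℝ) ^ 2 * ℓ x + δ) ^ 2 *
          (k (τ * η x) * ((a * (ζ x * ℓ v)) * (a' * (ζ x * ℓ w))))) atTop (𝓝 0) := by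
    intro δ x
    exact tendsto_mul_mul_sub ((hk.tendsto _).comp (tendsto_ripple ℓ η ζ δ τ a₀ x))
      (fun n => Real.abs_cos_le_one _) (tendsto_rippleDeriv_sub ℓ η ζ δ α a v x)
      (tendsto_rippleDeriv_sub ℓ η ζ δ α' a' w x)
  have hint := fun δ (n : ℕ) => h.integrable_ripple hB ℓ hk δ τ a₀ α a α' a' (n + 1) v w
  simp only [← integral_add (hint 0 _) (hint (Real.pi / 2) _)]
  refine tendsto_integral_of_dominated_convergence
    (fun x => ‖B x‖ * ((tsupport η).indicator (fun _ => D * (V * V')) x +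
      (tsupport η).indicator (fun _ => D * (V * V')) x))
    (fun n => ((hint 0 n).add (hint (Real.pi / 2) n)).1)
    (hB.norm.integrable_mul (hind.add hind)) (fun n => Eventually.of_forall fun x => ?_)
    (Eventually.of_forall fun x => ?_)
  · rw [← mul_add, norm_mul]
    gcongr
    exact (norm_add_le _ _).trans (add_le_add (hbound _ _ _) (hbound _ _ _))
  · have h1 := (hptw 0 x).add (hptw (Real.pi / 2) x)
    -- Wherever `ζ` does not vanish, `η = 1`, so `k` is evaluated at the constant `τ`.
    have e1 : k (τ * η x) * ((a * (ζ x * ℓ v)) * (a' * (ζ x * ℓ w))) =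
        ζ x ^ 2 * (k τ * (a * a') * (ℓ v * ℓ w)) := by
      by_cases hx : ζ x = 0
      · simp [hx]
      · rw [h.eq_one x hx, mul_one]; ring
    rw [add_zero, e1] at h1
    have h2 := (h1.add_const (ζ x ^ 2 * (k τ * (a * a') * (ℓ v * ℓ w)))).const_mul (B x)
    rw [zero_add] at h2
    refine h2.congr fun n => ?_
    simp only [Real.cos_add_pi_div_two, add_zero]
    linear_combination (-(B x * (ζ x ^ 2 * (k τ * (a * a') * (ℓ v * ℓ w))))) *
      Real.sin_sq_add_cos_sq ((n + 1 : ℝ) ^ 2 * ℓ x)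

end IsCutoffPair

theorem IsCutoffPair.ripple_nonneg {E : Type*} [NormedAddCommGroup E] [NormedSpace ℝ E]
    {η ζ : E → ℝ} (h : IsCutoffPair η ζ) (ℓ : E →L[ℝ] ℝ) (δ : ℝ) {τ a ν : ℝ} (hτ : 0 ≤ τ)
    (hν : 0 < ν) (ha : |a| ≤ τ * ν) (x : E) : 0 ≤ ripple η ζ ℓ δ τ a ν x := by
  rw [ripple]
  by_cases hx : ζ x = 0
  · simp only [hx, zero_mul, mul_zero, add_zero]
    exact mul_nonneg hτ (h.nonneg x)
  · rw [h.eq_one x hx, mul_one]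
    have h1 : |ζ x * Real.sin (ν ^ 2 * ℓ x + δ)| ≤ 1 := by
      rw [abs_mul, abs_of_nonneg (h.nonneg' x)]
      exact mul_le_one₀ (h.le_one' x) (abs_nonneg _) (Real.abs_sin_le_one _)
    have h2 : |a / ν * (ζ x * Real.sin (ν ^ 2 * ℓ x + δ))| ≤ τ := by
      rw [abs_mul, abs_div, abs_of_pos hν]
      exact (mul_le_of_le_one_right (by positivity) h1).trans ((div_le_iff₀ hν).2 ha)
    linarith [neg_abs_le (a / ν * (ζ x * Real.sin (ν ^ 2 * ℓ x + δ)))]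

theorem IsCutoffPair.tsupport_ripple_subset {E : Type*} [NormedAddCommGroup E] [NormedSpace ℝ E]
    {η ζ : E → ℝ} (h : IsCutoffPair η ζ) (ℓ : E →L[ℝ] ℝ) (δ τ a ν : ℝ) :
    tsupport (ripple η ζ ℓ δ τ a ν) ⊆ tsupport η := by
  refine closure_mono fun x hx hη => hx ?_
  have hζ : ζ x = 0 := by
    by_contra hζ
    exact one_ne_zero ((h.eq_one x hζ).symm.trans hη)
  simp [ripple, hζ, hη]

theorem IsCutoffPair.polarForm_ripple {N : ℕ} {Ω : TopologicalSpace.Opens (EuclideanSpace ℝ (Fin N))}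
    {A : EuclideanSpace ℝ (Fin N) → Matrix (Fin N) (Fin N) ℂ}
    (hA : ∀ i j, MemLp (fun x => A x i j) ∞ (volume.restrict Ω)) {k₁ k₂ k₃ : ℝ → ℝ}
    (hk₁ : Continuous k₁) (hk₂ : Continuous k₂)
    {η ζ : EuclideanSpace ℝ (Fin N) → ℝ} (h : IsCutoffPair η ζ)
    (ℓ : EuclideanSpace ℝ (Fin N) →L[ℝ] ℝ) (δ τ a b : ℝ) {ν : ℝ} (hν : ν ≠ 0) :
    polarForm Ω A k₁ k₂ k₃ (ripple η ζ ℓ δ τ a ν) (ripple η ζ ℓ δ 0 b ν) = ν ^ 2 *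
      ∑ i, ∑ j,
      (((∫ x in (Ω : Set (EuclideanSpace ℝ (Fin N))), (A x i j).re *
          (k₁ (ripple η ζ ℓ δ τ a ν x) *
            (rippleDeriv η ζ ℓ δ τ a ν (EuclideanSpace.single j 1) x *
              rippleDeriv η ζ ℓ δ τ a ν (EuclideanSpace.single i 1) x))) +
        ∫ x in (Ω : Set (EuclideanSpace ℝ (Fin N))), (A x i j).re *
          (k₂ (ripple η ζ ℓ δ τ a ν x) *
            (rippleDeriv η ζ ℓ δ 0 b ν (EuclideanSpace.single j 1) x *
              rippleDeriv η ζ ℓ δ 0 b ν (EuclideanSpace.single i 1) x))) +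
        ∫ x in (Ω : Set (EuclideanSpace ℝ (Fin N))), (A x i j).im *
          (k₃ (ripple η ζ ℓ δ τ a ν x) *
            (rippleDeriv η ζ ℓ δ τ a ν (EuclideanSpace.single j 1) x *
              rippleDeriv η ζ ℓ δ 0 b ν (EuclideanSpace.single i 1) x))) := by
  have hre : ∀ i j, MemLp (fun x => (A x i j).re) ∞ (volume.restrict Ω) := fun i j => (hA i j).re
  simp only [polarForm, fderiv_ripple ℓ h.contDiff h.contDiff' δ _ _ hν, Finset.mul_sum]
  refine Finset.sum_congr rfl fun i _ => Finset.sum_congr rfl fun j _ => ?_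
  rw [← integral_add (h.integrable_ripple (hre i j) ℓ hk₁ δ τ a τ a τ a ν _ _)
    (h.integrable_ripple (hre i j) ℓ hk₂ δ τ a 0 b 0 b ν _ _), mul_add,
    ← integral_const_mul, ← integral_const_mul]
  congr 1
  · refine integral_congr_ae (Eventually.of_forall fun x => ?_)
    simp only
    change (A x i j).re * _ = ν ^ 2 * ((A x i j).re * _ + (A x i j).re * _)
    ring
  · refine integral_congr_ae (Eventually.of_forall fun x => ?_)
    simp only
    ring

/-- Test with `ρ` equal to `τ η` plus a ripple of size `a` and `θ` a ripple of size `b`, both in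
direction `ξ`; divide by `ν²`, add the two phases and let `ν` tend to infinity. -/
theorem IsCutoffPair.integral_sq_mul_quadForm_nonneg {N : ℕ}
    {Ω : TopologicalSpace.Opens (EuclideanSpace ℝ (Fin N))}
    {A : EuclideanSpace ℝ (Fin N) → Matrix (Fin N) (Fin N) ℂ}
    (hA : ∀ i j, MemLp (fun x => A x i j) ∞ (volume.restrict Ω)) {k₁ k₂ k₃ : ℝ → ℝ}
    (hk₁ : Continuous k₁) (hk₂ : Continuous k₂) (hk₃ : Continuous k₃)
    (H : ∀ ρ θ : EuclideanSpace ℝ (Fin N) → ℝ, ContDiff ℝ 1 ρ → ContDiff ℝ 1 θ → (∀ x, 0 ≤ ρ x) →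
      HasCompactSupport ρ → tsupport ρ ⊆ Ω → 0 ≤ polarForm Ω A k₁ k₂ k₃ ρ θ)
    {η ζ : EuclideanSpace ℝ (Fin N) → ℝ} (h : IsCutoffPair η ζ) (hs : tsupport η ⊆ Ω)
    {τ : ℝ} (hτ : 0 < τ) (a b : ℝ) (ξ : Fin N → ℝ) :
    0 ≤ ∫ x in (Ω : Set (EuclideanSpace ℝ (Fin N))), ζ x ^ 2 *
      ((k₁ τ * (a * a) + k₂ τ * (b * b)) * quadForm ((A x).map Complex.re) ξ +
        k₃ τ * (a * b) * quadForm ((A x).map Complex.im) ξ) := by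
  have hre : ∀ i j, MemLp (fun x => (A x i j).re) ∞ (volume.restrict Ω) := fun i j => (hA i j).re
  have him : ∀ i j, MemLp (fun x => (A x i j).im) ∞ (volume.restrict Ω) := fun i j => (hA i j).im
  let ℓ : EuclideanSpace ℝ (Fin N) →L[ℝ] ℝ := ∑ i, ξ i • EuclideanSpace.proj i
  have hℓ : ∀ j, ℓ (EuclideanSpace.single j 1) = ξ j := fun j => by
    simp [ℓ]
  let e : Fin N → EuclideanSpace ℝ (Fin N) := fun i => EuclideanSpace.single i 1
  have hlim := tendsto_finsetSum (Finset.univ : Finset (Fin N)) fun i _ =>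
    tendsto_finsetSum (Finset.univ : Finset (Fin N)) fun j _ =>
      ((h.tendsto_integral_ripple (hre i j) ℓ hk₁ τ a τ a τ a (e j) (e i)).add
        (h.tendsto_integral_ripple (hre i j) ℓ hk₂ τ a 0 b 0 b (e j) (e i))).add
        (h.tendsto_integral_ripple (him i j) ℓ hk₃ τ a τ a 0 b (e j) (e i))
  have hnn := ge_of_tendsto hlim (b := 0) (by
    -- For such `n` the oscillation of `ρ` stays below `τ`, so `ρ ≥ 0` as `H` demands.
    obtain ⟨n₀, hn₀⟩ := exists_nat_gt (|a| / τ)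
    filter_upwards [eventually_ge_atTop n₀] with n hn
    have hν : (0 : ℝ) < n + 1 := by positivity
    have ha : |a| ≤ τ * (n + 1) := by
      rw [div_lt_iff₀ hτ] at hn₀
      have : (n₀ : ℝ) ≤ n := by exact_mod_cast hn
      nlinarith
    have hδ : ∀ δ : ℝ, 0 ≤ polarForm Ω A k₁ k₂ k₃ (ripple η ζ ℓ δ τ a (n + 1))
        (ripple η ζ ℓ δ 0 b (n + 1)) := fun δ =>
      H _ _ (contDiff_ripple ℓ h.contDiff h.contDiff' _ _ _ _)
        (contDiff_ripple ℓ h.contDiff h.contDiff' _ _ _ _)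
        (h.ripple_nonneg ℓ δ hτ.le hν ha)
        (h.hasCompactSupport.isCompact.of_isClosed_subset (isClosed_tsupport _)
          (h.tsupport_ripple_subset ℓ δ τ a _))
        ((h.tsupport_ripple_subset ℓ δ τ a _).trans hs)
    have h0 := hδ 0
    have h1 := hδ (Real.pi / 2)
    rw [h.polarForm_ripple hA hk₁ hk₂ ℓ _ _ _ _ hν.ne', mul_nonneg_iff_of_pos_left (by positivity)]
      at h0 h1
    refine (add_nonneg h0 h1).trans_eq ?_
    rw [← Finset.sum_add_distrib]
    refine Finset.sum_congr rfl fun i _ => ?_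
    rw [← Finset.sum_add_distrib]
    refine Finset.sum_congr rfl fun j _ => ?_
    simp only [e]
    ring)
  refine hnn.trans_eq ?_
  simp only [e, hℓ]
  have hζc : Continuous fun x => ζ x ^ 2 := h.contDiff'.continuous.pow 2
  have hζs : HasCompactSupport fun x => ζ x ^ 2 :=
    h.hasCompactSupport'.comp_left (g := fun t : ℝ => t ^ 2) (by simp)
  have hi : ∀ (c : ℝ) {B : EuclideanSpace ℝ (Fin N) → ℝ}, MemLp B ∞ (volume.restrict Ω) →
      Integrable (fun x => B x * (ζ x ^ 2 * c)) (volume.restrict Ω) := fun c B hB =>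
    integrable_mul_of_continuous hB (hζc.mul continuous_const) hζs.mul_right
  have hadd : ∀ i j, (∫ x in (Ω : Set (EuclideanSpace ℝ (Fin N))), (A x i j).re *
        (ζ x ^ 2 * (k₁ τ * (a * a) * (ξ j * ξ i)))) +
      (∫ x in (Ω : Set (EuclideanSpace ℝ (Fin N))), (A x i j).re *
        (ζ x ^ 2 * (k₂ τ * (b * b) * (ξ j * ξ i)))) =
      ∫ x in (Ω : Set (EuclideanSpace ℝ (Fin N))), (A x i j).re *
        (ζ x ^ 2 * ((k₁ τ * (a * a) + k₂ τ * (b * b)) * (ξ j * ξ i))) := fun i j => by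
    rw [← integral_add (hi _ (hre i j)) (hi _ (hre i j))]
    refine integral_congr_ae (Eventually.of_forall fun x => ?_)
    change (A x i j).re * _ + (A x i j).re * _ = (A x i j).re * _
    ring
  simp only [hadd]
  refine (sum_sum_integral_add (fun i j => hi _ (hre i j)) fun i j => hi _ (him i j)).trans ?_
  refine integral_congr_ae (Eventually.of_forall fun x => ?_)
  simp only [quadForm, dotProduct, Matrix.mulVec, Matrix.map_apply, Finset.sum_mul, Finset.mul_sum,
    ← Finset.sum_add_distrib]
  refine Finset.sum_congr rfl fun i _ => Finset.sum_congr rfl fun j _ => ?_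
  ring

/-! ### From cut-off integrals to pointwise inequalities. -/

theorem integral_closedBall_nonneg_of_cutoff {N : ℕ}
    {Ω : TopologicalSpace.Opens (EuclideanSpace ℝ (Fin N))} {q : EuclideanSpace ℝ (Fin N) → ℝ}
    (hq : MemLp q ∞ (volume.restrict Ω))
    (H : ∀ η ζ : EuclideanSpace ℝ (Fin N) → ℝ, IsCutoffPair η ζ → tsupport η ⊆ Ω →
      0 ≤ ∫ x in (Ω : Set (EuclideanSpace ℝ (Fin N))), ζ x ^ 2 * q x)
    {x : EuclideanSpace ℝ (Fin N)} {r : ℝ} (hr : 0 < r) (hs : Metric.closedBall x (3 * r) ⊆ Ω) :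
    0 ≤ ∫ y in (Ω : Set (EuclideanSpace ℝ (Fin N))),
      (Metric.closedBall x r).indicator (fun _ => (1 : ℝ)) y * q y := by
  have hrk : ∀ k : ℕ, 0 < r / (k + 1 : ℝ) := fun k => by positivity
  have hrk' : ∀ k : ℕ, r / (k + 1 : ℝ) ≤ r := fun k =>
    div_le_self hr.le (by linarith [k.cast_nonneg (α := ℝ)])
  -- The outer radii of the `ζ k` are at most `2 r`, so one `η` serves them all, while `ζ k ^ 2`
  -- tends pointwise to the indicator of the closed ball of radius `r`.
  let η : ContDiffBump x := ⟨2 * r, 3 * r, by linarith, by linarith⟩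
  let ζ : ℕ → ContDiffBump x := fun k => ⟨r, r + r / (k + 1), hr, by linarith [hrk k]⟩
  have hcut : ∀ k, IsCutoffPair η (ζ k) := fun k =>
    { contDiff := η.contDiff
      contDiff' := (ζ k).contDiff
      hasCompactSupport := η.hasCompactSupport
      nonneg := fun _ => η.nonneg
      nonneg' := fun _ => (ζ k).nonneg
      le_one' := fun _ => (ζ k).le_one
      eq_one := fun y hy => by
        refine η.one_of_mem_closedBall ?_
        have : y ∈ Function.support (ζ k) := hy
        rw [(ζ k).support_eq] at this
        refine Metric.ball_subset_closedBall (Metric.ball_subset_ball ?_ this)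
        change r + r / (k + 1) ≤ 2 * r
        linarith [hrk' k] }
  have hηs : tsupport η ⊆ Ω := by rw [η.tsupport_eq]; exact hs
  have hptw : ∀ y, Tendsto (fun k => ζ k y ^ 2) atTop
      (𝓝 ((Metric.closedBall x r).indicator (fun _ => (1 : ℝ)) y)) := by
    intro y
    refine tendsto_const_nhds.congr' ?_
    by_cases hy : y ∈ Metric.closedBall x r
    · refine Eventually.of_forall fun k => ?_
      simp only [indicator_of_mem hy, (ζ k).one_of_mem_closedBall hy, one_pow]
    · rw [indicator_of_notMem hy]
      have hy' : 0 < dist y x - r := by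
        have : r < dist y x := by simpa using hy
        linarith
      have hlim : Tendsto (fun k : ℕ => r / ((k : ℝ) + 1)) atTop (𝓝 0) := by
        have := (tendsto_one_div_add_atTop_nhds_zero_nat (𝕜 := ℝ)).const_mul r
        simpa [div_eq_mul_inv] using this
      filter_upwards [hlim.eventually (gt_mem_nhds hy')] with k hk
      rw [(ζ k).zero_of_le_dist, zero_pow two_ne_zero]
      change r + r / (k + 1) ≤ dist y x
      linarith
  have hK : MemLp ((Metric.closedBall x (2 * r)).indicator fun _ => (1 : ℝ)) 1
      (volume.restrict Ω) :=
    MemLp.restrict _ (memLp_indicator_const 1 Metric.isClosed_closedBall.measurableSet _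
      (Or.inr (isCompact_closedBall x (2 * r)).measure_lt_top.ne))
  refine ge_of_tendsto' (tendsto_integral_of_dominated_convergence
    (fun y => ‖q y‖ * (Metric.closedBall x (2 * r)).indicator (fun _ => (1 : ℝ)) y)
    (fun k => ?_) (hq.norm.integrable_mul hK) (fun k => Eventually.of_forall fun y => ?_)
    (Eventually.of_forall fun y => (hptw y).mul_const (q y))) fun k => H η (ζ k) (hcut k) hηs
  · exact ((ζ k).continuous.pow 2).aestronglyMeasurable.mul hq.1
  · rw [norm_mul, mul_comm]
    gcongr
    by_cases hy : y ∈ Metric.closedBall x (2 * r)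
    · rw [indicator_of_mem hy, Real.norm_of_nonneg (sq_nonneg _)]
      exact pow_le_one₀ (ζ k).nonneg (ζ k).le_one
    · rw [indicator_of_notMem hy, (ζ k).zero_of_le_dist]
      · simp
      · change r + r / (k + 1) ≤ dist y x
        have : 2 * r < dist y x := by simpa using hy
        linarith [hrk' k]

/-- Lebesgue differentiation: at almost every point `q` is the limit of its averages over small
balls, which are nonnegative. Extending `q` by zero makes it locally integrable on the whole space.
-/
theorem ae_nonneg_of_cutoff {N : ℕ}
    {Ω : TopologicalSpace.Opens (EuclideanSpace ℝ (Fin N))} {q : EuclideanSpace ℝ (Fin N) → ℝ}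
    (hq : MemLp q ∞ (volume.restrict Ω))
    (H : ∀ η ζ : EuclideanSpace ℝ (Fin N) → ℝ, IsCutoffPair η ζ → tsupport η ⊆ Ω →
      0 ≤ ∫ x in (Ω : Set (EuclideanSpace ℝ (Fin N))), ζ x ^ 2 * q x) :
    ∀ᵐ x ∂volume.restrict (Ω : Set (EuclideanSpace ℝ (Fin N))), 0 ≤ q x := by
  have hΩm : MeasurableSet (Ω : Set (EuclideanSpace ℝ (Fin N))) := Ω.isOpen.measurableSet
  have hq' : LocallyIntegrable ((Ω : Set (EuclideanSpace ℝ (Fin N))).indicator q) volume :=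
    ((memLp_indicator_iff_restrict hΩm).2 hq).locallyIntegrable le_top
  rw [ae_restrict_iff' hΩm]
  filter_upwards [IsUnifLocDoublingMeasure.ae_tendsto_average volume hq' 1] with x hx hxΩ
  obtain ⟨ε, hε, hball⟩ := Metric.nhds_basis_closedBall.mem_iff.1 (Ω.isOpen.mem_nhds hxΩ)
  let δ : ℕ → ℝ := fun n => ε / 3 * (1 / (n + 1))
  have hδ0 : ∀ n, 0 < δ n := fun n => by positivity
  have hδε : ∀ n, 3 * δ n ≤ ε := fun n => by
    have : (1 : ℝ) / (n + 1) ≤ 1 := by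
      rw [div_le_one (by positivity)]; linarith [n.cast_nonneg (α := ℝ)]
    simp only [δ]
    nlinarith
  have hδ : Tendsto δ atTop (𝓝[>] 0) := by
    refine tendsto_nhdsWithin_iff.2 ⟨?_, Eventually.of_forall hδ0⟩
    have := (tendsto_one_div_add_atTop_nhds_zero_nat (𝕜 := ℝ)).const_mul (ε / 3)
    rwa [mul_zero] at this
  have hlim := hx (fun _ => x) δ hδ (Eventually.of_forall fun n => by
    simpa using (hδ0 n).le)
  rw [indicator_of_mem hxΩ] at hlim
  refine ge_of_tendsto' hlim fun n => ?_
  rw [setAverage_eq, smul_eq_mul]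
  refine mul_nonneg (by positivity) ?_
  have h1 := integral_closedBall_nonneg_of_cutoff hq H (hδ0 n)
    ((Metric.closedBall_subset_closedBall (hδε n)).trans hball)
  refine h1.trans_eq ?_
  rw [← integral_indicator hΩm, ← integral_indicator Metric.isClosed_closedBall.measurableSet]
  refine integral_congr_ae (Eventually.of_forall fun y => ?_)
  by_cases h2 : y ∈ Metric.closedBall x (δ n) <;>
    by_cases h3 : y ∈ (Ω : Set (EuclideanSpace ℝ (Fin N))) <;>
    simp only [indicator, h2, h3, if_true, if_false, one_mul, zero_mul]

theorem memLp_quadForm {N : ℕ} {Ω : TopologicalSpace.Opens (EuclideanSpace ℝ (Fin N))}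
    {B : EuclideanSpace ℝ (Fin N) → Matrix (Fin N) (Fin N) ℝ}
    (hB : ∀ i j, MemLp (fun x => B x i j) ∞ (volume.restrict Ω)) (ξ : Fin N → ℝ) :
    MemLp (fun x => quadForm (B x) ξ) ∞ (volume.restrict Ω) := by
  simp only [quadForm, dotProduct, Matrix.mulVec, Finset.sum_mul]
  exact memLp_finsetSum _ fun i _ => memLp_finsetSum _ fun j _ =>
    ((hB i j).mul_const _).mul_const _

/-! ### Necessity of the algebraic condition, and the theorem. -/

namespace IsAdmissible

variable {φ : ℝ → ℝ}

theorem ae_quadForm_nonneg (hφ : IsAdmissible φ) {N : ℕ}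
    {Ω : TopologicalSpace.Opens (EuclideanSpace ℝ (Fin N))}
    {A : EuclideanSpace ℝ (Fin N) → Matrix (Fin N) (Fin N) ℂ}
    (hA : ∀ i j, MemLp (fun x => A x i j) ∞ (volume.restrict Ω))
    (hsymm : ∀ᵐ x ∂volume.restrict (Ω : Set (EuclideanSpace ℝ (Fin N))),
      ((A x).map Complex.im)ᵀ = (A x).map Complex.im)
    (hd : IsFunctionalDissipative Ω A φ) {s : ℝ} (hs : 0 < s) {σ : ℝ} (hσ : σ * σ = 1)
    (ξ : Fin N → ℝ) :
    ∀ᵐ x ∂volume.restrict (Ω : Set (EuclideanSpace ℝ (Fin N))),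
      0 ≤ 2 * quadForm ((A x).map Complex.re) ξ + σ * (s * deriv φ s) /
        Real.sqrt (φ s * deriv (fun σ => σ * φ σ) s) * quadForm ((A x).map Complex.im) ξ := by
  obtain ⟨m, hm, hW⟩ := hφ.exists_contDiff_powMul
  have hre : ∀ i j, MemLp (fun x => ((A x).map Complex.re) i j) ∞ (volume.restrict Ω) :=
    fun i j => (hA i j).re
  have him : ∀ i j, MemLp (fun x => ((A x).map Complex.im) i j) ∞ (volume.restrict Ω) :=
    fun i j => (hA i j).im
  refine ae_nonneg_of_cutoff (((memLp_quadForm hre ξ).const_mul 2).add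
    ((memLp_quadForm him ξ).const_mul _)) fun η ζ h hηs => ?_
  set ψ' := deriv (fun σ => σ * φ σ) s with hψ'
  have hψ'0 : 0 < ψ' := hφ.deriv_pos s hs
  have hφ0 : 0 < φ s := hφ.pos s hs
  -- The modulus of the test function is `ρ^m`, so `ρ` near `τ` means modulus near `s`.
  set τ := s ^ ((m : ℝ)⁻¹) with hτ
  have hτ0 : 0 < τ := Real.rpow_pos_of_pos hs _
  have hτm : τ ^ m = s := Real.rpow_inv_natCast_pow hs.le (by omega)
  have hm0 : (0 : ℝ) < m := by exact_mod_cast hm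
  set d := m * τ ^ (m - 1) with hd'
  have hd0 : 0 < d := by positivity
  have hcW := hW.continuous
  have hcW' : Continuous (deriv (powMul φ m)) := hW.continuous_deriv le_rfl
  have hWτ : powMul φ m τ = s * φ s := by rw [powMul_of_pos φ m hτ0, hτm]
  have hW'τ : deriv (powMul φ m) τ = d * ψ' := by
    rw [(hφ.hasDerivAt_powMul m hτ0).deriv, hτm]
  have hsψ : 0 < Real.sqrt ψ' := Real.sqrt_pos.2 hψ'0
  have hsφ : 0 < Real.sqrt (φ s) := Real.sqrt_pos.2 hφ0
  -- The sizes `a = 1/(d √ψ')` and `b = -σ/(s √φ)` normalize `k₁ a² = k₂ b² = 1` at `τ`, and the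
  -- mixed coefficient `k₃ a b` becomes `σ s φ' / √(φ ψ')`. Both signs of `σ` together bound the
  -- absolute value.
  have key := h.integral_sq_mul_quadForm_nonneg hA
    (k₁ := fun t => m * t ^ (m - 1) * deriv (powMul φ m) t) (k₂ := fun t => t ^ m * powMul φ m t)
    (k₃ := fun t => m * t ^ (m - 1) * powMul φ m t - deriv (powMul φ m) t * t ^ m)
    (by fun_prop) (by fun_prop) (by fun_prop)
    (fun ρ θ hρ hθ hρ0 hρc hρs => hd.polarForm_nonneg hA hsymm hm hW hρ hθ hρ0 hρc hρs) hηs hτ0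
    (1 / (d * Real.sqrt ψ')) (-σ / (s * Real.sqrt (φ s))) ξ
  refine key.trans_eq ?_
  refine integral_congr_ae (Eventually.of_forall fun x => ?_)
  simp only
  rw [← hd', hW'τ, hWτ, hτm]
  have e1 : d * (d * ψ') * (1 / (d * Real.sqrt ψ') * (1 / (d * Real.sqrt ψ'))) = 1 := by
    field_simp
    rw [Real.sq_sqrt hψ'0.le]
  have e2 : s * (s * φ s) * (-σ / (s * Real.sqrt (φ s)) * (-σ / (s * Real.sqrt (φ s)))) = 1 := by
    have : -σ / (s * Real.sqrt (φ s)) * (-σ / (s * Real.sqrt (φ s))) =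
        1 / (s * Real.sqrt (φ s)) ^ 2 := by
      rw [div_mul_div_comm, neg_mul_neg, hσ, sq]
    rw [this, mul_pow, Real.sq_sqrt hφ0.le]
    field_simp
  have e3 : (d * (s * φ s) - d * ψ' * s) * (1 / (d * Real.sqrt ψ') * (-σ / (s * Real.sqrt (φ s)))) =
      σ * (s * deriv φ s) / Real.sqrt (φ s * ψ') := by
    rw [Real.sqrt_mul hφ0.le]
    have : s * deriv φ s = ψ' - φ s := by rw [hψ', hφ.deriv_mul hs]; ring
    rw [this]
    field_simp
    ring
  rw [e1, e2, e3]
  ring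

/-- For each `(s, ξ)` the exceptional null set may differ. A countable dense set of pairs yields a
common one, and continuity of both sides in `(s, ξ)` extends the inequality to all pairs. -/
theorem ae_forall_le_of_isFunctionalDissipative (hφ : IsAdmissible φ) {N : ℕ}
    {Ω : TopologicalSpace.Opens (EuclideanSpace ℝ (Fin N))}
    {A : EuclideanSpace ℝ (Fin N) → Matrix (Fin N) (Fin N) ℂ}
    (hA : ∀ i j, MemLp (fun x => A x i j) ∞ (volume.restrict Ω))
    (hsymm : ∀ᵐ x ∂volume.restrict (Ω : Set (EuclideanSpace ℝ (Fin N))),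
      ((A x).map Complex.im)ᵀ = (A x).map Complex.im)
    (hd : IsFunctionalDissipative Ω A φ) :
    ∀ᵐ x ∂volume.restrict (Ω : Set (EuclideanSpace ℝ (Fin N))),
        ∀ s : ℝ, 0 < s → ∀ ξ : Fin N → ℝ,
          |s * deriv φ s| * |quadForm ((A x).map Complex.im) ξ| ≤
            2 * Real.sqrt (φ s * deriv (fun σ => σ * φ σ) s) *
              quadForm ((A x).map Complex.re) ξ := by
  let D : ℕ → Ioi (0 : ℝ) × (Fin N → ℝ) := TopologicalSpace.denseSeq _
  have hpos := ae_all_iff.2 fun n =>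
    hφ.ae_quadForm_nonneg hA hsymm hd (D n).1.2 (σ := 1) (by norm_num) (D n).2
  have hneg := ae_all_iff.2 fun n =>
    hφ.ae_quadForm_nonneg hA hsymm hd (D n).1.2 (σ := -1) (by norm_num) (D n).2
  filter_upwards [hpos, hneg] with x hx1 hx2
  suffices h : ∀ p : Ioi (0 : ℝ) × (Fin N → ℝ),
      |(p.1 : ℝ) * deriv φ p.1| * |quadForm ((A x).map Complex.im) p.2| ≤
        2 * Real.sqrt (φ p.1 * deriv (fun σ => σ * φ σ) p.1) *
          quadForm ((A x).map Complex.re) p.2 from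
    fun s hs ξ => h (⟨s, hs⟩, ξ)
  have hcq : ∀ B : Matrix (Fin N) (Fin N) ℝ, Continuous (quadForm B) := fun B => by
    unfold quadForm
    fun_prop
  have hc1 : Continuous fun s : Ioi (0 : ℝ) => φ s :=
    continuousOn_iff_continuous_domRestrict.1 hφ.contDiffOn.continuousOn
  have hc2 : Continuous fun s : Ioi (0 : ℝ) => deriv φ s :=
    continuousOn_iff_continuous_domRestrict.1 hφ.continuousOn_deriv
  have hc3 : Continuous fun s : Ioi (0 : ℝ) => deriv (fun σ => σ * φ σ) (s : ℝ) :=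
    continuousOn_iff_continuous_domRestrict.1 hφ.continuousOn_deriv_mul
  refine fun p => (TopologicalSpace.denseRange_denseSeq _).induction_on p ?_ ?_
  · refine isClosed_le ?_ ?_
    · exact ((continuous_subtype_val.comp continuous_fst).mul (hc2.comp continuous_fst)).abs.mul
        ((hcq _).comp continuous_snd).abs
    · exact (continuous_const.mul (((hc1.comp continuous_fst).mul (hc3.comp continuous_fst)).sqrt)).mul
        ((hcq _).comp continuous_snd)
  · intro n
    have h1 := hx1 n
    have h2 := hx2 n
    change |((D n).1 : ℝ) * deriv φ (D n).1| * |quadForm ((A x).map Complex.im) (D n).2| ≤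
        2 * Real.sqrt (φ (D n).1 * deriv (fun σ => σ * φ σ) (D n).1) *
          quadForm ((A x).map Complex.re) (D n).2
    have hs : (0 : ℝ) < (D n).1 := (D n).1.2
    set s : ℝ := ((D n).1 : ℝ)
    set w := Real.sqrt (φ s * deriv (fun σ => σ * φ σ) s) with hw
    have hw0 : 0 < w := Real.sqrt_pos.2 (mul_pos (hφ.pos s hs) (hφ.deriv_pos s hs))
    set P := quadForm ((A x).map Complex.re) (D n).2
    set Q := quadForm ((A x).map Complex.im) (D n).2
    rw [← abs_mul]
    have e1 : w * (2 * P + 1 * (s * deriv φ s) / w * Q) = 2 * w * P + s * deriv φ s * Q := by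
      field_simp
    have e2 : w * (2 * P + -1 * (s * deriv φ s) / w * Q) = 2 * w * P - s * deriv φ s * Q := by
      field_simp
      ring
    have h1' := mul_nonneg hw0.le h1
    have h2' := mul_nonneg hw0.le h2
    rw [e1] at h1'
    rw [e2] at h2'
    exact abs_le.2 ⟨by linarith, by linarith⟩

end IsAdmissible

theorem theorem1 {N : ℕ} (Ω : TopologicalSpace.Opens (EuclideanSpace ℝ (Fin N)))
    (A : EuclideanSpace ℝ (Fin N) → Matrix (Fin N) (Fin N) ℂ)
    (hA : ∀ i j, MemLp (fun x => A x i j) ∞ (volume.restrict Ω))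
    (hsymm : ∀ᵐ x ∂volume.restrict (Ω : Set (EuclideanSpace ℝ (Fin N))),
      ((A x).map Complex.im)ᵀ = (A x).map Complex.im)
    (φ : ℝ → ℝ) (hφ : IsAdmissible φ) :
    IsFunctionalDissipative Ω A φ ↔
      ∀ᵐ x ∂volume.restrict (Ω : Set (EuclideanSpace ℝ (Fin N))),
        ∀ s : ℝ, 0 < s → ∀ ξ : Fin N → ℝ,
          |s * deriv φ s| * |quadForm ((A x).map Complex.im) ξ| ≤
            2 * Real.sqrt (φ s * deriv (fun σ => σ * φ σ) s) *
              quadForm ((A x).map Complex.re) ξ :=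
  ⟨hφ.ae_forall_le_of_isFunctionalDissipative hA hsymm,
    hφ.isFunctionalDissipative_of_forall_le hsymm⟩
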